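/- **Setting.** Let $1\le k<d$, let $\xi:\mathbb{R}^d\to\mathbb{R}^k$ be smooth and let $V,\overline V:\mathbb{R}^d\to\mathbb{R}$ be of class $C^2$. Let $\nabla\xi(x)\in\mathbb{R}^{d\times k}$ be the matrix with entries $\partial\xi_j/\partial x_i(x)$. Assume that $\Sigma=\{x\in\mathbb{R}^d : \xi(x)=0\}$ is compact and that $\nabla\xi(x)^T\nabla\xi(x)$ is positive definite for all $x\in\Sigma$, so that $\Sigma$ is a $(d-k)$-dimensional submanifold. Let $\sigma_\Sigma$ be its surface (Riemannian) measure induced by the Euclidean scalar product, let $\beta>0$ and $\tau>0$, and set $$\nu_\Sigma(dx)=Z^{-1}e^{-\beta V(x)}\,\sigma_\Sigma(dx),\qquad Z=\int_\Sigma e^{-\beta V}\,d\sigma_\Sigma .$$ For $x\in\Sigma$ let $U_x\in\mathbb{R}^{d\times(d-k)}$ have columns forming an orthonormal basis of $T_x\Sigma$, with $x\mapsto U_x$ measurable. For $x,y\in\Sigma$ and $v\in\mathbb{R}^{d-k}$ put $$G_x(y)=\tfrac{1}{\sqrt{2\tau}}U_x^T\big(y-x+\tau\nabla\overline V(x)\big),\qquad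 C_x=\{y\in\Sigma:\det(\nabla\xi(y)^T\nabla\xi(x))=0\},$$ $$\mathcal F_x(v)=\{y\in\Sigma:\exists\, c\in\mathbb{R}^k,\ y=x-\tau\nabla\overline V(x)+\sqrt{2\tau}\,U_xv+\nabla\xi(x)c\}.$$ **The projection map.** For all $x\in\Sigma$ and $v\in\mathbb{R}^{d-k}$ let $\Psi_x(v)\subseteq\mathcal F_x(v)$, and let $\mathrm{Im}\,\Psi_x=\bigcup_{v}\Psi_x(v)$. Assume: 1. $\Psi_x(v)$ is finite (possibly empty) for all $x,v$; 2. $\mathcal D=\{(x,y)\in\Sigma\times\Sigma : y\in\mathrm{Im}\,\Psi_x,\ x\in\mathrm{Im}\,\Psi_y\}$ is non-empty and measurable; 3. for all $x,v$, writing $\Psi_x(v)\setminus C_x=\{y_1,\dots,y_m\}$ with $m\ge1$ whenever this set is non-empty, there are an open neighborhood $\mathcal O$ of $v$ and $m$ different $C^1$-diffeomorphisms $\Psi_x^{(j)}:\mathcal O\to\Psi_x^{(j)}(\mathcal O)\subset\Sigma$ such that $\Psi_x^{(j)}(v)=y_j$ and $\Psi_x^{(j)}(\bar v)\in\Psi_x(\bar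 v)$ for all $\bar v\in\mathcal O$. Let $\omega(y\,|\,x,v)\in(0,1]$, for $y\in\Psi_x(v)$, be measurable in $(y,x,v)$ with $\sum_{y\in\Psi_x(v)}\omega(y\,|\,x,v)=1$ whenever $\Psi_x(v)\neq\emptyset$. **The algorithm (multiple projection MALA; random walk Metropolis–Hastings if $\overline V=0$).** From the current state $x\in\Sigma$, the next state is obtained as follows. * Draw $v\in\mathbb{R}^{d-k}$ with density $(2\pi\beta^{-1})^{-(d-k)/2}e^{-\beta|v|^2/2}$. If $\Psi_x(v)=\emptyset$, stay at $x$. * Otherwise draw $y\in\Psi_x(v)$ with probability $\omega(y\,|\,x,v)$ and set $v'=G_y(x)$. If $x\notin\Psi_y(v')$, stay at $x$. * Otherwise draw $r$ uniformly in $[0,1]$; move to $y$ if $r\le a(y\,|\,x)$, and stay at $x$ if not, where, with $v=G_x(y)$ and $v'=G_y(x)$, $$a(y\,|\,x)=\min\Big\{1,\ \frac{\omega(x\,|\,y,v')}{\omega(y\,|\,x,v)}\,e^{-\beta[(V(y)+\frac12|v'|^2)-(V(x)+\frac12|v|^2)]}\Big\}.$$ **Theorem.** $\nu_\Sigma$ is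 a probability measure, and the law $q(x,dy)$ of the next state given the current state $x$ is a Markov transition kernel on $\Sigma$ which is reversible with respect to $\nu_\Sigma$: for every bounded measurable $f:\Sigma\times\Sigma\to\mathbb{R}$, $$\int_{\Sigma\times\Sigma} f(x,y)\,q(x,dy)\,\nu_\Sigma(dx)=\int_{\Sigma\times\Sigma} f(y,x)\,q(x,dy)\,\nu_\Sigma(dx).$$ In particular the Markov chain preserves $\nu_\Sigma$: $\int_\Sigma q(x,B)\,\nu_\Sigma(dx)=\nu_\Sigma(B)$ for every measurable $B\subseteq\Sigma$. -/

import Mathlib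

open MeasureTheory ProbabilityTheory Matrix
open scoped ContDiff

noncomputable section

namespace MultiProjMALA

/-- `ℝⁿ` with its Euclidean structure. -/
abbrev Eu (n : ℕ) : Type := EuclideanSpace ℝ (Fin n)

/-- The matrix-vector product on Euclidean spaces. -/
def act {m n : ℕ} (A : Matrix (Fin m) (Fin n) ℝ) (v : Eu n) : Eu m :=
  WithLp.toLp 2 (A *ᵥ v.ofLp)

/-- The level set `Σ = ξ⁻¹(0)`. -/
def levelSet {d k : ℕ} (ξ : Eu d → Eu k) : Set (Eu d) := {x | ξ x = 0}

/-- The `d × k` matrix `∇ξ(x)`, with entries `(∇ξ(x))ᵢⱼ = ∂ξⱼ/∂xᵢ (x)`. -/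
def grad {d k : ℕ} (ξ : Eu d → Eu k) (x : Eu d) : Matrix (Fin d) (Fin k) ℝ :=
  Matrix.of fun i j => (fderiv ℝ ξ x (EuclideanSpace.single i 1)) j

/-- Standing assumptions on `ξ` and on the potentials `V`, `Vb`. -/
structure ConstraintAssumption {d k : ℕ} (ξ : Eu d → Eu k) (V Vb : Eu d → ℝ) : Prop where
  V_C2 : ContDiff ℝ 2 V
  Vb_C2 : ContDiff ℝ 2 Vb
  smooth : ContDiff ℝ ∞ ξ
  compact : IsCompact (levelSet ξ)
  posDef : ∀ x ∈ levelSet ξ, ((grad ξ x)ᵀ * grad ξ x).PosDef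

section SurfaceMeasure

variable {d k : ℕ} (ξ : Eu d → Eu k)

/-- `φ` is a `C¹`-diffeomorphism from the open set `O ⊆ ℝ^{d-k}` onto its image in `Σ`: an injective
`C¹` immersion. Since `Σ` has dimension `d - k`, its image is then open in `Σ` and its inverse is
`C¹`, by the inverse function theorem. -/
structure IsC1Diffeo (O : Set (Eu (d - k))) (φ : Eu (d - k) → levelSet ξ) : Prop where
  isOpen : IsOpen O
  contDiffOn : ContDiffOn ℝ 1 (fun v => (φ v : Eu d)) O
  injOn : Set.InjOn φ O
  immersion : ∀ v ∈ O, Function.Injective (fderiv ℝ (fun w => (φ w : Eu d)) v)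

/-- The Riemannian area element `√ det ⟨∂ᵢφ(v), ∂ⱼφ(v)⟩` of a parametrization `φ`, for the metric
induced by the Euclidean scalar product. -/
def areaElement (φ : Eu (d - k) → levelSet ξ) (v : Eu (d - k)) : ℝ :=
  Real.sqrt (Matrix.of fun i j : Fin (d - k) =>
    inner ℝ (fderiv ℝ (fun w => (φ w : Eu d)) v (EuclideanSpace.single i 1))
      (fderiv ℝ (fun w => (φ w : Eu d)) v (EuclideanSpace.single j 1))).det

/-- The Riemannian measure carried by the image `φ(O)` of a local parametrization: the image under
`φ` of the area element times Lebesgue measure on `O`. -/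
def chartMeasure (O : Set (Eu (d - k))) (φ : Eu (d - k) → levelSet ξ) : Measure (levelSet ξ) :=
  ((volume.restrict O).withDensity fun v => ENNReal.ofReal (areaElement ξ φ v)).map φ

/-- The surface measure `σ_Σ` on `Σ`, i.e. its Riemannian measure for the metric induced by the
Euclidean scalar product. The measures `chartMeasure ξ O φ` agree on the overlaps of the open sets
`φ(O)`, which cover `Σ`; the measure glued from them, whose restriction to each `φ(O)` is
`chartMeasure ξ O φ`, is their supremum in the complete lattice of measures. -/
def surfaceMeasure : Measure (levelSet ξ) :=
  sSup {μ | ∃ (O : Set (Eu (d - k))) (φ : Eu (d - k) → levelSet ξ),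
    IsC1Diffeo ξ O φ ∧ μ = chartMeasure ξ O φ}

/-- The unnormalized measure `exp (-β V) σ_Σ`. -/
def weightedSurface (V : Eu d → ℝ) (β : ℝ) : Measure (levelSet ξ) :=
  (surfaceMeasure ξ).withDensity fun x => ENNReal.ofReal (Real.exp (-β * V x))

/-- The target `ν_Σ = Z⁻¹ exp (-β V) σ_Σ`, where `Z` is the total mass of `exp (-β V) σ_Σ`. -/
def targetMeasure (V : Eu d → ℝ) (β : ℝ) : Measure (levelSet ξ) :=
  (weightedSurface ξ V β Set.univ)⁻¹ • weightedSurface ξ V β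

end SurfaceMeasure

section Algorithm

variable {d k : ℕ} (ξ : Eu d → Eu k) (V Vb : Eu d → ℝ) (β τ : ℝ)
  (U : levelSet ξ → Matrix (Fin d) (Fin (d - k)) ℝ)
  (Ψ : levelSet ξ → Eu (d - k) → Set (levelSet ξ))
  (sel : levelSet ξ → levelSet ξ → Eu (d - k) → ℝ)

/-- For every `x ∈ Σ`, the columns of `U x` form an orthonormal basis of the tangent space
`T_x Σ = {w | ∇ξ(x)ᵀ w = 0}`. The basis depends measurably on `x`. -/
structure IsTangentFrame : Prop where
  orthonormal : ∀ x, (U x)ᵀ * U x = 1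
  range_eq : ∀ (x : levelSet ξ) (w : Eu d),
    act (grad ξ x)ᵀ w = 0 ↔ ∃ v : Eu (d - k), act (U x) v = w
  measurable : ∀ i j, Measurable fun x => U x i j

/-- The unconstrained move
`F_x(v, c) = x - τ ∇Vb(x) + √(2τ) U_x v + ∇ξ(x) c`. -/
def move (x : levelSet ξ) (v : Eu (d - k)) (c : Eu k) : Eu d :=
  (x : Eu d) - τ • gradient Vb x + Real.sqrt (2 * τ) • act (U x) v + act (grad ξ x) c

/-- The set `𝓕_x(v)` of all points of `Σ` of the form `F_x(v, c)`. -/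
def allProjections (x : levelSet ξ) (v : Eu (d - k)) : Set (levelSet ξ) :=
  {y | ∃ c : Eu k, (y : Eu d) = move ξ Vb τ U x v c}

/-- The velocity `G_x(y) = (2τ)^{-1/2} U_xᵀ (y - x + τ ∇Vb(x))`. -/
def velocity (x y : levelSet ξ) : Eu (d - k) :=
  (1 / Real.sqrt (2 * τ)) • act (U x)ᵀ ((y : Eu d) - x + τ • gradient Vb x)

/-- The set `C_x = {y ∈ Σ | det (∇ξ(y)ᵀ ∇ξ(x)) = 0}`. -/
def criticalSet (x : levelSet ξ) : Set (levelSet ξ) :=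
  {y | ((grad ξ y)ᵀ * grad ξ x).det = 0}

/-- `Im Ψ_x`, the set of points that can be proposed from `x`. -/
def imPsi (x : levelSet ξ) : Set (levelSet ξ) := {y | ∃ v, y ∈ Ψ x v}

/-- The set `𝓓` of pairs `(x, y)` with `y ∈ Im Ψ_x` and `x ∈ Im Ψ_y`. -/
def admissibleSet : Set (levelSet ξ × levelSet ξ) :=
  {p | p.2 ∈ imPsi ξ Ψ p.1 ∧ p.1 ∈ imPsi ξ Ψ p.2}

/-- `Ψ` is a set-valued proposal map (`Ψ_x(v) ⊆ 𝓕_x(v)`) with finite values, whose admissible set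
is non-empty and measurable, and such that through the non-critical points of `Ψ_x(v)` there pass
local branches of `Ψ_x` which are `C¹`-diffeomorphisms, all defined on one neighborhood of `v`. The
branches are indexed by the points of `Ψ_x(v) \ C_x`. -/
structure ProjectionAssumption : Prop where
  subset : ∀ x v, Ψ x v ⊆ allProjections ξ Vb τ U x v
  finite : ∀ x v, (Ψ x v).Finite
  nonempty : (admissibleSet ξ Ψ).Nonempty
  measurable : MeasurableSet (admissibleSet ξ Ψ)
  branches : ∀ x v, ∃ (O : Set (Eu (d - k))) (ψ : levelSet ξ → Eu (d - k) → levelSet ξ),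
    IsOpen O ∧ v ∈ O ∧ ∀ y ∈ Ψ x v \ criticalSet ξ x,
      IsC1Diffeo ξ O (ψ y) ∧ ψ y v = y ∧ ∀ w ∈ O, ψ y w ∈ Ψ x w

/-- The weights `ω(y | x, v)`, written `sel y x v`, for `y ∈ Ψ_x(v)`: positive probabilities
summing to one, measurable as a function on the set of `(y, x, v)` with `y ∈ Ψ_x(v)`, where they
are meaningful. -/
structure IsSelectionProbability : Prop where
  pos : ∀ x v, ∀ y ∈ Ψ x v, 0 < sel y x v
  le_one : ∀ x v, ∀ y ∈ Ψ x v, sel y x v ≤ 1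
  sum_eq_one : ∀ x v, (Ψ x v).Nonempty → ∑ᶠ y ∈ Ψ x v, sel y x v = 1
  measurable : Measurable
    fun p : {p : levelSet ξ × levelSet ξ × Eu (d - k) // p.1 ∈ Ψ p.2.1 p.2.2} =>
      sel p.1.1 p.1.2.1 p.1.2.2

/-- The Gaussian measure `(2π/β)^{-n/2} exp (-β |v|² / 2) dv` on `ℝⁿ`. -/
def gaussian (n : ℕ) : Measure (Eu n) :=
  volume.withDensity fun v =>
    ENNReal.ofReal ((2 * Real.pi / β) ^ (-(n : ℝ) / 2) * Real.exp (-β * ‖v‖ ^ 2 / 2))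

/-- The acceptance probability `a(y | x)`, with `v = G_x(y)` and `v' = G_y(x)`. -/
def acceptProb (y x : levelSet ξ) : ℝ :=
  let v := velocity ξ Vb τ U x y
  let v' := velocity ξ Vb τ U y x
  min 1 (sel x y v' / sel y x v *
    Real.exp (-β * ((V y + 1 / 2 * ‖v'‖ ^ 2) - (V x + 1 / 2 * ‖v‖ ^ 2))))

open Classical in
/-- Law of the next state when the state is `x` and the proposal is `y`: if the reversibility check
`x ∈ Ψ_y(v')`, `v' = G_y(x)`, fails, the chain stays at `x`; otherwise `r` is drawn uniformly in
`[0, 1]`, and the next state is `y` if `r ≤ a(y | x)` and `x` if not. -/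
def stepGivenProposal (x y : levelSet ξ) : Measure (levelSet ξ) :=
  if x ∈ Ψ y (velocity ξ Vb τ U y x) then
    (volume.restrict (Set.Icc (0 : ℝ) 1)).map
      fun r => if r ≤ acceptProb ξ V Vb β τ U sel y x then y else x
  else Measure.dirac x

open Classical in
/-- Law of the next state when the state is `x` and the velocity is `v`: the chain stays at `x` if
`Ψ_x(v)` is empty; otherwise the proposal is `y ∈ Ψ_x(v)` with probability `ω(y | x, v)`. -/
def stepGivenVelocity (x : levelSet ξ) (v : Eu (d - k)) : Measure (levelSet ξ) :=
  if Ψ x v = ∅ then Measure.dirac x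
  else Measure.sum fun y : Ψ x v =>
    ENNReal.ofReal (sel y x v) • stepGivenProposal ξ V Vb β τ U Ψ sel x y

/-- Law of the next state when the state is `x`: one iteration of the algorithm, in which the
velocity `v` is drawn from the Gaussian measure. -/
def step (x : levelSet ξ) : Measure (levelSet ξ) :=
  (gaussian β (d - k)).bind (stepGivenVelocity ξ V Vb β τ U Ψ sel x)

end Algorithm

/-- Reversibility of the Markov chain with transition kernel `q` with respect to `ν`:
`∫ f(x, y) q(x, dy) ν(dx) = ∫ f(y, x) q(x, dy) ν(dx)` for all bounded measurable `f`. -/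
def IsReversibleChain {X : Type*} [MeasurableSpace X] (q : Kernel X X) (ν : Measure X) : Prop :=
  ∀ f : X × X → ℝ, Measurable f → (∃ C, ∀ p, |f p| ≤ C) →
    ∫ x, ∫ y, f (x, y) ∂(q x) ∂ν = ∫ x, ∫ y, f (y, x) ∂(q x) ∂ν

end MultiProjMALA

end

noncomputable section

namespace MultiProjMALA

section LinearAlgebra

/-- `act A` as a continuous linear map. -/
def actL {m n : ℕ} (A : Matrix (Fin m) (Fin n) ℝ) : Eu n →L[ℝ] Eu m :=
  LinearMap.toContinuousLinearMap (Matrix.toLpLin 2 2 A)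

@[simp] lemma actL_apply {m n : ℕ} (A : Matrix (Fin m) (Fin n) ℝ) (v : Eu n) :
    actL A v = act A v := rfl

lemma act_mul {l m n : ℕ} (A : Matrix (Fin l) (Fin m) ℝ) (B : Matrix (Fin m) (Fin n) ℝ)
    (v : Eu n) : act (A * B) v = act A (act B v) := by
  simp [act, Matrix.mulVec_mulVec]

lemma act_one {n : ℕ} (v : Eu n) : act (1 : Matrix (Fin n) (Fin n) ℝ) v = v := by
  simp [act]

lemma act_single {m n : ℕ} (A : Matrix (Fin m) (Fin n) ℝ) (i : Fin n) (j : Fin m) :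
    act A (EuclideanSpace.single i 1) j = A j i := by
  simp [act]

lemma actL_comp {l m n : ℕ} (A : Matrix (Fin l) (Fin m) ℝ) (B : Matrix (Fin m) (Fin n) ℝ) :
    (actL A).comp (actL B) = actL (A * B) := by
  ext1 v; simp [act_mul]

lemma det_actL {n : ℕ} (A : Matrix (Fin n) (Fin n) ℝ) : (actL A).det = A.det := by
  rw [ContinuousLinearMap.det]
  have : ((actL A : Eu n →L[ℝ] Eu n) : Eu n →ₗ[ℝ] Eu n)
      = Matrix.toLin (PiLp.basisFun 2 ℝ (Fin n)) (PiLp.basisFun 2 ℝ (Fin n)) A := by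
    rw [← Matrix.toLpLin_eq_toLin]; rfl
  rw [this, LinearMap.det_toLin]

lemma exists_actL_eq {m n : ℕ} (T : Eu n →L[ℝ] Eu m) :
    ∃ A : Matrix (Fin m) (Fin n) ℝ, T = actL A := by
  refine ⟨(Matrix.toLpLin 2 2).symm (T : Eu n →ₗ[ℝ] Eu m), ?_⟩
  ext1 v
  have : Matrix.toLpLin 2 2 ((Matrix.toLpLin 2 2).symm (T : Eu n →ₗ[ℝ] Eu m))
      = (T : Eu n →ₗ[ℝ] Eu m) := LinearEquiv.apply_symm_apply _ _
  exact (congrArg (fun f : Eu n →ₗ[ℝ] Eu m => f v) this).symm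

lemma det_comp {n : ℕ} (S T : Eu n →L[ℝ] Eu n) : (S.comp T).det = S.det * T.det :=
  LinearMap.det_comp _ _

lemma inner_act_of_transpose_mul {m n : ℕ} {A : Matrix (Fin m) (Fin n) ℝ} (hA : Aᵀ * A = 1)
    (v w : Eu n) : inner ℝ (act A v) (act A w) = inner ℝ v w := by
  simp only [act, EuclideanSpace.inner_eq_star_dotProduct, star_trivial]
  rw [Matrix.dotProduct_mulVec, Matrix.vecMul_mulVec, ← Matrix.dotProduct_mulVec]
  simp [hA]

/-- The Gram determinant of the columns of an endomorphism of `ℝⁿ`. -/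
lemma det_gram {n : ℕ} (T : Eu n →L[ℝ] Eu n) :
    (Matrix.of fun i j : Fin n => (inner ℝ (T (EuclideanSpace.single i 1))
      (T (EuclideanSpace.single j 1)) : ℝ)).det = T.det ^ 2 := by
  obtain ⟨A, rfl⟩ := exists_actL_eq T
  rw [det_actL, sq]
  nth_rewrite 1 [← Matrix.det_transpose A]
  rw [← Matrix.det_mul]
  congr 1
  ext i j
  simp only [Matrix.of_apply, actL_apply, EuclideanSpace.inner_eq_star_dotProduct, star_trivial,
    Matrix.mul_apply, Matrix.transpose_apply, dotProduct]
  refine Finset.sum_congr rfl fun l _ => ?_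
  rw [act_single, act_single, mul_comm]

lemma act_grad_transpose {d k : ℕ} (ξ : Eu d → Eu k) (x w : Eu d) :
    act (grad ξ x)ᵀ w = fderiv ℝ ξ x w := by
  obtain ⟨A, hA⟩ := exists_actL_eq (fderiv ℝ ξ x)
  have : (grad ξ x)ᵀ = A := by
    ext i j
    simp only [grad, Matrix.transpose_apply, Matrix.of_apply, hA, actL_apply, act_single]
  rw [this, hA, actL_apply]

lemma measurable_det {α : Type*} [MeasurableSpace α] {n : ℕ} {M : α → Matrix (Fin n) (Fin n) ℝ}
    (hM : ∀ i j, Measurable fun a => M a i j) : Measurable fun a => (M a).det := by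
  simp only [Matrix.det_apply]
  exact Finset.measurable_fun_sum _ fun σ _ =>
    (Finset.measurable_fun_prod _ fun i _ => hM _ _).const_smul _

end LinearAlgebra

section Charts

variable {d k : ℕ} {ξ : Eu d → Eu k} {U : levelSet ξ → Matrix (Fin d) (Fin (d - k)) ℝ}

lemma IsTangentFrame.fderiv_eq_zero_iff (hU : IsTangentFrame ξ U) (x : levelSet ξ) (w : Eu d) :
    fderiv ℝ ξ x w = 0 ↔ ∃ v : Eu (d - k), act (U x) v = w := by
  rw [← act_grad_transpose, hU.range_eq]

lemma IsTangentFrame.act_transpose_act (hU : IsTangentFrame ξ U) (x : levelSet ξ)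
    (v : Eu (d - k)) : act (U x)ᵀ (act (U x) v) = v := by
  rw [← act_mul, hU.orthonormal, act_one]

lemma IsTangentFrame.act_act_transpose (hU : IsTangentFrame ξ U) (x : levelSet ξ)
    {w : Eu d} (hw : fderiv ℝ ξ x w = 0) : act (U x) (act (U x)ᵀ w) = w := by
  obtain ⟨v, rfl⟩ := (hU.fderiv_eq_zero_iff x w).1 hw
  rw [hU.act_transpose_act]

variable {O : Set (Eu (d - k))} {φ : Eu (d - k) → levelSet ξ}

lemma IsC1Diffeo.mono (h : IsC1Diffeo ξ O φ) {O' : Set (Eu (d - k))} (hO' : IsOpen O')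
    (hsub : O' ⊆ O) : IsC1Diffeo ξ O' φ where
  isOpen := hO'
  contDiffOn := h.contDiffOn.mono hsub
  injOn := h.injOn.mono hsub
  immersion v hv := h.immersion v (hsub hv)

lemma IsC1Diffeo.hasFDerivAt (h : IsC1Diffeo ξ O φ) {w : Eu (d - k)} (hw : w ∈ O) :
    HasFDerivAt (fun w => (φ w : Eu d)) (fderiv ℝ (fun w => (φ w : Eu d)) w) w :=
  ((h.contDiffOn.differentiableOn one_ne_zero).differentiableAt
    (h.isOpen.mem_nhds hw)).hasFDerivAt

lemma IsC1Diffeo.fderiv_constraint (h : IsC1Diffeo ξ O φ) (hξ : Differentiable ℝ ξ)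
    {w : Eu (d - k)} (hw : w ∈ O) (u : Eu (d - k)) :
    fderiv ℝ ξ (φ w) (fderiv ℝ (fun w => (φ w : Eu d)) w u) = 0 := by
  have h1 := ((hξ (φ w)).hasFDerivAt).comp w (h.hasFDerivAt hw)
  have h2 : (ξ ∘ fun w => (φ w : Eu d)) = fun _ => 0 := by
    funext z; exact (φ z).2
  rw [h2] at h1
  have h3 := h1.unique (hasFDerivAt_const (0 : Eu k) w)
  exact congrArg (fun T : Eu (d - k) →L[ℝ] Eu k => T u) h3

/-- The coordinates of the differential of a parametrization in the tangent frame. -/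
def frameDeriv (U : levelSet ξ → Matrix (Fin d) (Fin (d - k)) ℝ) (φ : Eu (d - k) → levelSet ξ)
    (w : Eu (d - k)) : Eu (d - k) →L[ℝ] Eu (d - k) :=
  (actL (U (φ w))ᵀ).comp (fderiv ℝ (fun w => (φ w : Eu d)) w)

lemma IsC1Diffeo.fderiv_eq (h : IsC1Diffeo ξ O φ) (hξ : Differentiable ℝ ξ)
    (hU : IsTangentFrame ξ U) {w : Eu (d - k)} (hw : w ∈ O) :
    fderiv ℝ (fun w => (φ w : Eu d)) w = (actL (U (φ w))).comp (frameDeriv U φ w) := by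
  ext1 u
  exact (hU.act_act_transpose (φ w) (h.fderiv_constraint hξ hw u)).symm

lemma IsC1Diffeo.areaElement_eq (h : IsC1Diffeo ξ O φ) (hξ : Differentiable ℝ ξ)
    (hU : IsTangentFrame ξ U) {w : Eu (d - k)} (hw : w ∈ O) :
    areaElement ξ φ w = |(frameDeriv U φ w).det| := by
  have : areaElement ξ φ w = Real.sqrt ((frameDeriv U φ w).det ^ 2) := by
    rw [areaElement, ← det_gram]
    congr 2
    ext i j
    simp only [Matrix.of_apply]
    rw [h.fderiv_eq hξ hU hw]
    simp only [ContinuousLinearMap.comp_apply, actL_apply]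
    exact inner_act_of_transpose_mul (hU.orthonormal _) _ _
  rw [this, Real.sqrt_sq_eq_abs]

/-- The Jacobian at `y` of the restriction of a linear map to `T_y Σ`, in the frame `U`. -/
def tangentJac (U : levelSet ξ → Matrix (Fin d) (Fin (d - k)) ℝ) (L : Eu d →L[ℝ] Eu (d - k))
    (y : levelSet ξ) : ℝ := |(L.comp (actL (U y))).det|

lemma IsC1Diffeo.abs_det_comp (h : IsC1Diffeo ξ O φ) (hξ : Differentiable ℝ ξ)
    (hU : IsTangentFrame ξ U) (L : Eu d →L[ℝ] Eu (d - k)) {w : Eu (d - k)} (hw : w ∈ O) :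
    |(L.comp (fderiv ℝ (fun w => (φ w : Eu d)) w)).det|
      = tangentJac U L (φ w) * areaElement ξ φ w := by
  rw [h.areaElement_eq hξ hU hw, tangentJac, ← abs_mul, ← det_comp]
  conv_lhs => rw [h.fderiv_eq hξ hU hw]
  rfl

lemma measurable_tangentJac (hU : IsTangentFrame ξ U) (L : Eu d →L[ℝ] Eu (d - k)) :
    Measurable (tangentJac U L) := by
  obtain ⟨A, rfl⟩ := exists_actL_eq L
  have : tangentJac U (actL A) = fun y => |(A * U y).det| := by
    funext y; rw [tangentJac, actL_comp, det_actL]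
  rw [this]
  refine (measurable_det fun i j => ?_).abs
  simp only [Matrix.mul_apply]
  exact Finset.measurable_fun_sum _ fun l _ => (hU.measurable _ _).const_mul _

end Charts

section ChartArea

variable {d k : ℕ} {ξ : Eu d → Eu k} {U : levelSet ξ → Matrix (Fin d) (Fin (d - k)) ℝ}
  {O : Set (Eu (d - k))} {φ : Eu (d - k) → levelSet ξ}

lemma isClosed_levelSet (hξ : Continuous ξ) : IsClosed (levelSet ξ) :=
  isClosed_eq hξ continuous_const

lemma IsC1Diffeo.continuousOn (h : IsC1Diffeo ξ O φ) : ContinuousOn φ O := by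
  rw [Topology.IsInducing.subtypeVal.continuousOn_iff]
  exact h.contDiffOn.continuousOn

lemma IsC1Diffeo.measurableSet_image (h : IsC1Diffeo ξ O φ) : MeasurableSet (φ '' O) :=
  h.isOpen.measurableSet.image_of_continuousOn_injOn h.continuousOn h.injOn

lemma IsC1Diffeo.measurableSet_inter_preimage (h : IsC1Diffeo ξ O φ) {A : Set (levelSet ξ)}
    (hA : MeasurableSet A) : MeasurableSet (O ∩ φ ⁻¹' A) := by
  have h1 : Measurable (O.domRestrict φ) := (continuousOn_iff_continuous_domRestrict.1
    h.continuousOn).measurable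
  have h2 : O ∩ φ ⁻¹' A = Subtype.val '' (O.domRestrict φ ⁻¹' A) := by
    ext w; simp [Set.domRestrict, and_comm]
  rw [h2]
  exact h.isOpen.measurableSet.subtype_image (h1 hA)

lemma measurable_areaElement (φ : Eu (d - k) → levelSet ξ) : Measurable (areaElement ξ φ) := by
  refine (measurable_det fun i j => ?_).sqrt
  have h (i : Fin (d - k)) : Measurable fun v =>
      fderiv ℝ (fun w => (φ w : Eu d)) v (EuclideanSpace.single i 1) :=
    (measurable_fderiv ℝ _).apply_continuousLinearMap _
  exact (h i).inner (h j)

lemma IsC1Diffeo.lintegral_chartMeasure (h : IsC1Diffeo ξ O φ) {A : Set (levelSet ξ)}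
    (hA : MeasurableSet A) {g : levelSet ξ → ENNReal} (hg : Measurable g) :
    ∫⁻ y in A, g y ∂(chartMeasure ξ O φ)
      = ∫⁻ w in O ∩ φ ⁻¹' A, ENNReal.ofReal (areaElement ξ φ w) * g (φ w) := by
  have hφ : AEMeasurable φ (volume.restrict O) :=
    h.continuousOn.aemeasurable h.isOpen.measurableSet
  have ha : Measurable fun w => ENNReal.ofReal (areaElement ξ φ w) :=
    (measurable_areaElement φ).ennreal_ofReal
  have hφ' : AEMeasurable φ ((volume.restrict O).withDensity
      fun v => ENNReal.ofReal (areaElement ξ φ v)) :=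
    hφ.mono_ac (withDensity_absolutelyContinuous _ _)
  rw [← lintegral_indicator hA, chartMeasure, lintegral_map' (hg.indicator hA).aemeasurable hφ',
    lintegral_withDensity_eq_lintegral_mul₀ (g := fun w => A.indicator g (φ w)) ha.aemeasurable
      ((hg.indicator hA).comp_aemeasurable hφ),
    ← lintegral_indicator h.isOpen.measurableSet,
    ← lintegral_indicator (h.measurableSet_inter_preimage hA)]
  refine lintegral_congr fun w => ?_
  by_cases hw : w ∈ O <;> by_cases hw' : φ w ∈ A <;> simp [hw, hw']

lemma IsC1Diffeo.hasFDerivAt_comp (h : IsC1Diffeo ξ O φ) (L : Eu d →L[ℝ] Eu (d - k))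
    (b : Eu (d - k)) {w : Eu (d - k)} (hw : w ∈ O) :
    HasFDerivAt (fun w => L (φ w : Eu d) + b)
      (L.comp (fderiv ℝ (fun w => (φ w : Eu d)) w)) w :=
  (L.hasFDerivAt.comp w (h.hasFDerivAt hw)).add_const b

lemma image_eq_of_subset_image {A : Set (levelSet ξ)} (hAO : A ⊆ φ '' O)
    (G : levelSet ξ → Eu (d - k)) :
    (fun w => G (φ w)) '' (O ∩ φ ⁻¹' A) = G '' A := by
  ext v
  constructor
  · rintro ⟨w, ⟨-, hw⟩, rfl⟩; exact ⟨_, hw, rfl⟩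
  · rintro ⟨y, hy, rfl⟩
    obtain ⟨w, hw, rfl⟩ := hAO hy
    exact ⟨w, ⟨hw, hy⟩, rfl⟩

lemma IsC1Diffeo.volume_image (h : IsC1Diffeo ξ O φ) (hξ : Differentiable ℝ ξ)
    (hU : IsTangentFrame ξ U) (L : Eu d →L[ℝ] Eu (d - k)) (b : Eu (d - k))
    {A : Set (levelSet ξ)} (hA : MeasurableSet A) (hAO : A ⊆ φ '' O)
    (hinj : Set.InjOn (fun y : levelSet ξ => L (y : Eu d) + b) A) :
    volume ((fun y : levelSet ξ => L (y : Eu d) + b) '' A)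
      = ∫⁻ y in A, ENNReal.ofReal (tangentJac U L y) ∂(chartMeasure ξ O φ) := by
  rw [h.lintegral_chartMeasure hA (measurable_tangentJac hU L).ennreal_ofReal,
    ← image_eq_of_subset_image hAO, ← lintegral_abs_det_fderiv_eq_addHaar_image volume
      (h.measurableSet_inter_preimage hA)
      (fun w hw => (h.hasFDerivAt_comp L b hw.1).hasFDerivWithinAt)]
  · refine setLIntegral_congr_fun (h.measurableSet_inter_preimage hA) fun w hw => ?_
    rw [h.abs_det_comp hξ hU L hw.1, mul_comm]
    exact ENNReal.ofReal_mul (Real.sqrt_nonneg _)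
  · intro w hw w' hw' e
    exact h.injOn hw.1 hw'.1 (hinj hw.2 hw'.2 e)

lemma IsC1Diffeo.volume_image_eq_zero (h : IsC1Diffeo ξ O φ) (hξ : Differentiable ℝ ξ)
    (hU : IsTangentFrame ξ U) (L : Eu d →L[ℝ] Eu (d - k)) (b : Eu (d - k))
    {A : Set (levelSet ξ)} (hAO : A ⊆ φ '' O) (hJ : ∀ y ∈ A, tangentJac U L y = 0) :
    volume ((fun y : levelSet ξ => L (y : Eu d) + b) '' A) = 0 := by
  rw [← image_eq_of_subset_image hAO]
  refine addHaar_image_eq_zero_of_det_fderivWithin_eq_zero volume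
    (fun w hw => (h.hasFDerivAt_comp L b hw.1).hasFDerivWithinAt) fun w hw => ?_
  rw [← abs_eq_zero, h.abs_det_comp hξ hU L hw.1, hJ _ hw.2, zero_mul]

lemma IsC1Diffeo.continuousOn_areaElement (h : IsC1Diffeo ξ O φ) :
    ContinuousOn (areaElement ξ φ) O := by
  have h1 : ContinuousOn (fderiv ℝ (fun w => (φ w : Eu d))) O :=
    h.contDiffOn.continuousOn_fderiv_of_isOpen h.isOpen le_rfl
  refine Real.continuous_sqrt.comp_continuousOn ?_
  simp only [Matrix.det_apply, Matrix.of_apply]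
  refine continuousOn_finsetSum _ fun σ _ =>
    (continuousOn_finsetProd _ fun i _ => ?_).const_smul _
  exact (h1.clm_apply continuousOn_const).inner (h1.clm_apply continuousOn_const)

end ChartArea

section ChartExistence

variable {d k : ℕ} {ξ : Eu d → Eu k} {U : levelSet ξ → Matrix (Fin d) (Fin (d - k)) ℝ}

lemma finrank_graph (hkd : k ≤ d) :
    Module.finrank ℝ (Eu d) = Module.finrank ℝ (Eu k × Eu (d - k)) := by
  simp; omega

/-- Around a point at which the linear map `L` is nonsingular on the tangent space, `Σ` is
parametrized by the inverse of `L`. -/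
lemma exists_chart_inverse (hkd : k ≤ d) (hξ : ContDiff ℝ ∞ ξ) (hU : IsTangentFrame ξ U)
    (L : Eu d →L[ℝ] Eu (d - k)) (y : levelSet ξ) (hL : tangentJac U L y ≠ 0) :
    ∃ (O : Set (Eu (d - k))) (φ : Eu (d - k) → levelSet ξ), IsC1Diffeo ξ O φ ∧
      (∀ v ∈ O, L (φ v : Eu d) = v) ∧ y ∈ φ '' O ∧ IsOpen (φ '' O) := by
  have hξ1 : ContDiff ℝ 1 ξ := hξ.of_le (by exact_mod_cast le_top)
  set F : Eu d → Eu k × Eu (d - k) := fun z => (ξ z, L z) with hF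
  have hFc : ContDiff ℝ 1 F := hξ1.prodMk L.contDiff
  set F' : Eu d →L[ℝ] Eu k × Eu (d - k) := (fderiv ℝ ξ y).prod L with hF'
  have hFF' : HasFDerivAt F F' y :=
    ((hξ1.differentiable one_ne_zero) y).hasFDerivAt.prodMk L.hasFDerivAt
  have hker : LinearMap.ker (F' : Eu d →ₗ[ℝ] Eu k × Eu (d - k)) = ⊥ := by
    rw [LinearMap.ker_eq_bot']
    intro w hw
    have hw1 : fderiv ℝ ξ y w = 0 := congrArg Prod.fst hw
    have hw2 : L w = 0 := congrArg Prod.snd hw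
    obtain ⟨u, rfl⟩ := (hU.fderiv_eq_zero_iff y w).1 hw1
    have hdet : (L.comp (actL (U y))).det ≠ 0 := fun h0 => hL (by rw [tangentJac, h0, abs_zero])
    have : u = 0 := by
      refine ((L.comp (actL (U y))).toContinuousLinearEquivOfDetNeZero hdet).injective ?_
      rw [map_zero]
      exact hw2
    simp [this, act]
  set e : Eu d ≃L[ℝ] Eu k × Eu (d - k) :=
    (LinearEquiv.ofInjectiveOfFinrankEq (F' : Eu d →ₗ[ℝ] Eu k × Eu (d - k))
      (LinearMap.ker_eq_bot.1 hker) (finrank_graph hkd)).toContinuousLinearEquiv with he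
  have hFe : HasFDerivAt F (e : Eu d →L[ℝ] Eu k × Eu (d - k)) y := by
    have : (e : Eu d →L[ℝ] Eu k × Eu (d - k)) = F' := by ext1 w; rfl
    rw [this]; exact hFF'
  set f := hFc.contDiffAt.toOpenPartialHomeomorph F hFe one_ne_zero with hf
  have hfF : ⇑f = F := ContDiffAt.toOpenPartialHomeomorph_coe _ hFe one_ne_zero
  have hys : (y : Eu d) ∈ f.source :=
    ContDiffAt.mem_toOpenPartialHomeomorph_source _ hFe one_ne_zero
  have hsymm : ContDiffAt ℝ 1 f.symm (F y) :=
    hFc.contDiffAt.to_localInverse hFe one_ne_zero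
  have htgt : F y ∈ f.target := by rw [← hfF]; exact f.map_source hys
  obtain ⟨N, hNsub, hNo, hyN⟩ := mem_nhds_iff.1
    ((hsymm.eventually (by simp)).and (f.open_target.mem_nhds htgt))
  have hinv : ∀ v : Eu (d - k), ((0 : Eu k), v) ∈ N →
      ξ (f.symm (0, v)) = 0 ∧ L (f.symm (0, v)) = v := by
    intro v hv
    have := f.right_inv (hNsub hv).2
    rw [hfF] at this
    exact ⟨congrArg Prod.fst this, congrArg Prod.snd this⟩
  classical
  set φ : Eu (d - k) → levelSet ξ := fun v =>
    if h : ξ (f.symm (0, v)) = 0 then ⟨f.symm (0, v), h⟩ else y with hφ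
  set O : Set (Eu (d - k)) := (fun v => ((0 : Eu k), v)) ⁻¹' N with hO
  have hOo : IsOpen O := hNo.preimage (by fun_prop)
  have hφO : ∀ v ∈ O, (φ v : Eu d) = f.symm (0, v) := by
    intro v hv
    simp only [hφ, dif_pos (hinv v hv).1]
  have hLφ : ∀ v ∈ O, L (φ v : Eu d) = v := fun v hv => by rw [hφO v hv, (hinv v hv).2]
  have hcd : ContDiffOn ℝ 1 (fun v => (φ v : Eu d)) O := by
    refine ContDiffOn.congr (f := fun v => f.symm (0, v)) ?_ hφO
    intro v hv
    have h1 : ContDiffAt ℝ 1 f.symm ((0 : Eu k), v) := (hNsub hv).1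
    exact (h1.comp v (contDiffAt_const.prodMk contDiffAt_id)).contDiffWithinAt
  have himg : φ '' O = {z : levelSet ξ | (z : Eu d) ∈ f.source ∩ F ⁻¹' N} := by
    ext z
    constructor
    · rintro ⟨v, hv, rfl⟩
      have hz : F (φ v) = (0, v) := Prod.ext (φ v).2 (hLφ v hv)
      refine ⟨?_, ?_⟩
      · rw [hφO v hv]; exact f.map_target (hNsub hv).2
      · show F (φ v) ∈ N
        rw [hz]; exact hv
    · rintro ⟨hz1, hz2⟩
      have hz : F z = (0, L z) := Prod.ext z.2 rfl
      have hzO : L (z : Eu d) ∈ O := by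
        show ((0 : Eu k), L (z : Eu d)) ∈ N
        rw [← hz]; exact hz2
      refine ⟨L z, hzO, Subtype.ext ?_⟩
      rw [hφO _ hzO, ← hz, ← hfF, f.left_inv hz1]
  refine ⟨O, φ, ⟨hOo, hcd, ?_, ?_⟩, hLφ, ?_, ?_⟩
  · intro v hv w hw hvw
    rw [← hLφ v hv, ← hLφ w hw, hvw]
  · intro v hv u u' huu
    have h1 : HasFDerivAt (fun w => (φ w : Eu d)) (fderiv ℝ (fun w => (φ w : Eu d)) v) v :=
      ((hcd.differentiableOn one_ne_zero).differentiableAt (hOo.mem_nhds hv)).hasFDerivAt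
    have h2 := L.hasFDerivAt.comp v h1
    have h3 : HasFDerivAt (fun w => L (φ w : Eu d)) (ContinuousLinearMap.id ℝ _) v :=
      (hasFDerivAt_id v).congr_of_eventuallyEq
        (Filter.eventually_of_mem (hOo.mem_nhds hv) hLφ)
    have h4 := fun u => congrArg (fun T : Eu (d - k) →L[ℝ] Eu (d - k) => T u) (h2.unique h3)
    have h5 := h4 u
    have h6 := h4 u'
    simp only [ContinuousLinearMap.comp_apply, ContinuousLinearMap.id_apply] at h5 h6
    rw [← h5, ← h6, huu]
  · rw [himg]; exact ⟨hys, hyN⟩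
  · rw [himg]
    exact (f.open_source.inter (hNo.preimage hFc.continuous)).preimage continuous_subtype_val

/-- The charts of `exists_chart_inverse`, shrunk to have finite mass. -/
lemma exists_chart (hkd : k ≤ d) (hξ : ContDiff ℝ ∞ ξ) (hU : IsTangentFrame ξ U)
    (L : Eu d →L[ℝ] Eu (d - k)) (y : levelSet ξ) (hL : tangentJac U L y ≠ 0) :
    ∃ (O : Set (Eu (d - k))) (φ : Eu (d - k) → levelSet ξ), IsC1Diffeo ξ O φ ∧
      (∀ v ∈ O, L (φ v : Eu d) = v) ∧ y ∈ φ '' O ∧ IsOpen (φ '' O) ∧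
      chartMeasure ξ O φ Set.univ < ⊤ := by
  obtain ⟨O, φ, hφ, hLφ, ⟨v₀, hv₀, rfl⟩, hop⟩ := exists_chart_inverse hkd hξ hU L y hL
  have hev : ∀ᶠ v in nhds v₀, areaElement ξ φ v < areaElement ξ φ v₀ + 1 ∧ v ∈ O :=
    ((hφ.continuousOn_areaElement.continuousAt (hφ.isOpen.mem_nhds hv₀)).eventually_lt_const
      (lt_add_one _)).and (hφ.isOpen.mem_nhds hv₀)
  obtain ⟨r, hr, hball⟩ := Metric.mem_nhds_iff.1 hev
  have hsub : Metric.ball v₀ r ⊆ O := fun v hv => (hball hv).2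
  have hφ' := hφ.mono Metric.isOpen_ball hsub
  refine ⟨Metric.ball v₀ r, φ, hφ', fun v hv => hLφ v (hsub hv),
    ⟨v₀, Metric.mem_ball_self hr, rfl⟩, ?_, ?_⟩
  · have : φ '' Metric.ball v₀ r
        = φ '' O ∩ (fun z : levelSet ξ => L (z : Eu d)) ⁻¹' Metric.ball v₀ r := by
      ext z
      constructor
      · rintro ⟨v, hv, rfl⟩
        refine ⟨⟨v, hsub hv, rfl⟩, ?_⟩
        rw [Set.mem_preimage, hLφ v (hsub hv)]; exact hv
      · rintro ⟨⟨v, hv, rfl⟩, hz⟩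
        rw [Set.mem_preimage, hLφ v hv] at hz
        exact ⟨v, hz, rfl⟩
    rw [this]
    exact hop.inter (Metric.isOpen_ball.preimage (by fun_prop))
  · have h1 := hφ'.lintegral_chartMeasure (A := Set.univ) MeasurableSet.univ
      (g := fun _ => 1) measurable_const
    simp only [Measure.restrict_univ, lintegral_const, one_mul, Set.preimage_univ,
      Set.inter_univ, mul_one] at h1
    rw [h1]
    calc ∫⁻ w in Metric.ball v₀ r, ENNReal.ofReal (areaElement ξ φ w)
        ≤ ∫⁻ w in Metric.ball v₀ r, ENNReal.ofReal (areaElement ξ φ v₀ + 1) :=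
          setLIntegral_mono measurable_const fun w hw =>
            ENNReal.ofReal_le_ofReal (hball hw).1.le
      _ < ⊤ := by
          rw [setLIntegral_const]
          exact ENNReal.mul_lt_top ENNReal.ofReal_lt_top measure_ball_lt_top

end ChartExistence

section Gluing

variable {d k : ℕ} {ξ : Eu d → Eu k} {U : levelSet ξ → Matrix (Fin d) (Fin (d - k)) ℝ}

lemma IsC1Diffeo.tangentJac_ne_zero {O : Set (Eu (d - k))} {φ : Eu (d - k) → levelSet ξ}
    (h : IsC1Diffeo ξ O φ) (hξ : Differentiable ℝ ξ) (hU : IsTangentFrame ξ U)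
    {L : Eu d →L[ℝ] Eu (d - k)} (hL : ∀ v ∈ O, L (φ v : Eu d) = v) {y : levelSet ξ}
    (hy : y ∈ φ '' O) : tangentJac U L y ≠ 0 := by
  obtain ⟨v, hv, rfl⟩ := hy
  have h2 := L.hasFDerivAt.comp v (h.hasFDerivAt hv)
  have h3 : HasFDerivAt (fun w => L (φ w : Eu d)) (ContinuousLinearMap.id ℝ _) v :=
    (hasFDerivAt_id v).congr_of_eventuallyEq
      (Filter.eventually_of_mem (h.isOpen.mem_nhds hv) hL)
  have h4 := h.abs_det_comp hξ hU L hv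
  rw [h2.unique h3, ContinuousLinearMap.det, ContinuousLinearMap.coe_id, LinearMap.det_id,
    abs_one] at h4
  intro h0
  rw [h0, zero_mul] at h4
  exact one_ne_zero h4

lemma injOn_image_of_inverse {O : Set (Eu (d - k))} {φ : Eu (d - k) → levelSet ξ}
    {L : Eu d →L[ℝ] Eu (d - k)} (hL : ∀ v ∈ O, L (φ v : Eu d) = v) :
    Set.InjOn (fun y : levelSet ξ => L (y : Eu d)) (φ '' O) := by
  rintro _ ⟨v, hv, rfl⟩ _ ⟨w, hw, rfl⟩ h
  simp only [hL v hv, hL w hw] at h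
  rw [h]

/-- The chart measures agree on overlaps. -/
lemma chartMeasure_apply_eq {O O' : Set (Eu (d - k))} {φ φ' : Eu (d - k) → levelSet ξ}
    (h : IsC1Diffeo ξ O φ) (h' : IsC1Diffeo ξ O' φ') (hξ : Differentiable ℝ ξ)
    (hU : IsTangentFrame ξ U) {L : Eu d →L[ℝ] Eu (d - k)} (hL : ∀ v ∈ O', L (φ' v : Eu d) = v)
    {A : Set (levelSet ξ)} (hA : MeasurableSet A) (hAO : A ⊆ φ '' O) (hAO' : A ⊆ φ' '' O') :
    chartMeasure ξ O φ A = chartMeasure ξ O' φ' A := by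
  have hJm : Measurable fun y => ENNReal.ofReal (tangentJac U L y) :=
    (measurable_tangentJac hU L).ennreal_ofReal
  have key : ((chartMeasure ξ O φ).restrict A).withDensity
        (fun y => ENNReal.ofReal (tangentJac U L y))
      = ((chartMeasure ξ O' φ').restrict A).withDensity
        (fun y => ENNReal.ofReal (tangentJac U L y)) := by
    ext E hE
    have hinj : Set.InjOn (fun y : levelSet ξ => L (y : Eu d) + 0) (E ∩ A) := by
      simp only [add_zero]
      exact (injOn_image_of_inverse hL).mono (Set.inter_subset_right.trans hAO')
    rw [withDensity_apply _ hE, withDensity_apply _ hE, Measure.restrict_restrict hE,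
      Measure.restrict_restrict hE,
      ← h.volume_image hξ hU L 0 (hE.inter hA) (Set.inter_subset_right.trans hAO) hinj,
      ← h'.volume_image hξ hU L 0 (hE.inter hA) (Set.inter_subset_right.trans hAO') hinj]
  have inv (μ : Measure (levelSet ξ)) : ((μ.restrict A).withDensity
      (fun y => ENNReal.ofReal (tangentJac U L y))).withDensity
        (fun y => (ENNReal.ofReal (tangentJac U L y))⁻¹) = μ.restrict A := by
    refine withDensity_inv_same hJm ?_ (Filter.Eventually.of_forall fun _ => ENNReal.ofReal_ne_top)
    filter_upwards [ae_restrict_mem hA] with y hy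
    have := h'.tangentJac_ne_zero hξ hU hL (hAO' hy)
    rw [Ne, ENNReal.ofReal_eq_zero, not_le]
    exact lt_of_le_of_ne (abs_nonneg _) this.symm
  have h1 := inv (chartMeasure ξ O φ)
  rw [key, inv] at h1
  rw [← Measure.restrict_apply_self (chartMeasure ξ O φ), ← h1, Measure.restrict_apply_self]

lemma tangentJac_transpose_self (hU : IsTangentFrame ξ U) (y : levelSet ξ) :
    tangentJac U (actL (U y)ᵀ) y = 1 := by
  rw [tangentJac, actL_comp, det_actL, hU.orthonormal, Matrix.det_one, abs_one]

lemma exists_chart_cover [Nonempty (levelSet ξ)] (hkd : k ≤ d) (hξ : ContDiff ℝ ∞ ξ)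
    (hU : IsTangentFrame ξ U) :
    ∃ (O : ℕ → Set (Eu (d - k))) (φ : ℕ → Eu (d - k) → levelSet ξ)
      (L : ℕ → Eu d →L[ℝ] Eu (d - k)), (∀ i, IsC1Diffeo ξ (O i) (φ i)) ∧
      (∀ i, ∀ v ∈ O i, L i (φ i v : Eu d) = v) ∧ ⋃ i, φ i '' O i = Set.univ := by
  have h1 (y : levelSet ξ) := exists_chart_inverse hkd hξ hU (actL (U y)ᵀ) y
    (by rw [tangentJac_transpose_self hU]; exact one_ne_zero)
  choose O φ hφ hL hy hop using h1
  obtain ⟨s, hs, hcov⟩ := TopologicalSpace.countable_cover_nhds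
    fun y => (hop y).mem_nhds (hy y)
  have hne : s.Nonempty := by
    rw [Set.nonempty_iff_ne_empty]
    rintro rfl
    simp only [Set.mem_empty_iff_false, Set.iUnion_false, Set.iUnion_empty] at hcov
    exact Set.empty_ne_univ hcov
  obtain ⟨a, rfl⟩ := hs.exists_eq_range hne
  refine ⟨fun i => O (a i), fun i => φ (a i), fun i => actL (U (a i))ᵀ, fun i => hφ _,
    fun i => hL _, ?_⟩
  rw [← hcov, Set.biUnion_range]

/-- The surface measure restricts to the chart measures. -/
theorem surfaceMeasure_apply_of_subset [Nonempty (levelSet ξ)] (hkd : k ≤ d)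
    (hξ : ContDiff ℝ ∞ ξ) (hU : IsTangentFrame ξ U) {O : Set (Eu (d - k))}
    {φ : Eu (d - k) → levelSet ξ} (h : IsC1Diffeo ξ O φ) {A : Set (levelSet ξ)}
    (hA : MeasurableSet A) (hAO : A ⊆ φ '' O) :
    surfaceMeasure ξ A = chartMeasure ξ O φ A := by
  have hξd : Differentiable ℝ ξ := hξ.differentiable (by simp)
  obtain ⟨O', φ', L, hφ', hL, hcov⟩ := exists_chart_cover hkd hξ hU
  set B : ℕ → Set (levelSet ξ) := disjointed fun i => φ' i '' O' i with hB
  have hBm : ∀ i, MeasurableSet (B i) :=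
    MeasurableSet.disjointed fun i => (hφ' i).measurableSet_image
  have hBsub : ∀ i, B i ⊆ φ' i '' O' i := disjointed_subset _
  have hBd : Pairwise (Function.onFun Disjoint B) := disjoint_disjointed _
  have hBcov : ⋃ i, B i = Set.univ := by rw [hB, iUnion_disjointed, hcov]
  have hsplit (μ : Measure (levelSet ξ)) {E : Set (levelSet ξ)} (hE : MeasurableSet E) :
      μ E = ∑' i, μ (E ∩ B i) := by
    rw [← measure_iUnion (fun i j hij => (hBd hij).mono Set.inter_subset_right
      Set.inter_subset_right) fun i => hE.inter (hBm i), ← Set.inter_iUnion, hBcov,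
      Set.inter_univ]
  set m : Measure (levelSet ξ) :=
    Measure.sum fun i => (chartMeasure ξ (O' i) (φ' i)).restrict (B i) with hm
  have hmA {E : Set (levelSet ξ)} (hE : MeasurableSet E) :
      m E = ∑' i, chartMeasure ξ (O' i) (φ' i) (E ∩ B i) := by
    rw [hm, Measure.sum_apply _ hE]
    exact tsum_congr fun i => Measure.restrict_apply hE
  have hchart {O : Set (Eu (d - k))} {φ : Eu (d - k) → levelSet ξ} (h : IsC1Diffeo ξ O φ)
      {A : Set (levelSet ξ)} (hA : MeasurableSet A) (hAO : A ⊆ φ '' O) :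
      m A = chartMeasure ξ O φ A := by
    rw [hmA hA, hsplit (chartMeasure ξ O φ) hA]
    exact tsum_congr fun i => (chartMeasure_apply_eq h (hφ' i) hξd hU (hL i)
      (hA.inter (hBm i)) (Set.inter_subset_left.trans hAO)
      (Set.inter_subset_right.trans (hBsub i))).symm
  have hσ : surfaceMeasure ξ = m := by
    refine le_antisymm (sSup_le ?_) ?_
    · rintro _ ⟨O, φ, h, rfl⟩
      refine Measure.le_iff.2 fun E hE => ?_
      have h0 : chartMeasure ξ O φ (φ '' O)ᶜ = 0 := by
        have := h.lintegral_chartMeasure (g := fun _ => 1) h.measurableSet_image.compl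
          measurable_const
        rw [setLIntegral_one] at this
        rw [this]
        have hemp : O ∩ φ ⁻¹' (φ '' O)ᶜ = ∅ := by
          ext w
          simp only [Set.mem_inter_iff, Set.mem_preimage, Set.mem_compl_iff,
            Set.mem_empty_iff_false, iff_false, not_and, not_not]
          exact fun hw => ⟨w, hw, rfl⟩
        rw [hemp, Measure.restrict_empty, lintegral_zero_measure]
      calc chartMeasure ξ O φ E ≤ chartMeasure ξ O φ (E ∩ φ '' O)
            + chartMeasure ξ O φ (φ '' O)ᶜ := by
            refine (measure_mono ?_).trans (measure_union_le _ _)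
            intro y hy
            by_cases hyO : y ∈ φ '' O
            · exact Or.inl ⟨hy, hyO⟩
            · exact Or.inr hyO
        _ = m (E ∩ φ '' O) := by
            rw [h0, add_zero, hchart h (hE.inter h.measurableSet_image) Set.inter_subset_right]
        _ ≤ m E := measure_mono Set.inter_subset_left
    · refine Measure.le_iff.2 fun E hE => ?_
      rw [hmA hE, hsplit (surfaceMeasure ξ) hE]
      refine ENNReal.tsum_le_tsum fun i => ?_
      exact (le_sSup ⟨O' i, φ' i, hφ' i, rfl⟩ :
        chartMeasure ξ (O' i) (φ' i) ≤ surfaceMeasure ξ) _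
  rw [hσ, hchart h hA hAO]

theorem surfaceMeasure_univ_lt_top [Nonempty (levelSet ξ)] (hkd : k ≤ d)
    (hξ : ContDiff ℝ ∞ ξ) (hc : IsCompact (levelSet ξ)) (hU : IsTangentFrame ξ U) :
    surfaceMeasure ξ Set.univ < ⊤ := by
  have h1 (y : levelSet ξ) := exists_chart hkd hξ hU (actL (U y)ᵀ) y
    (by rw [tangentJac_transpose_self hU]; exact one_ne_zero)
  choose O φ hφ hL hy hop hfin using h1
  have : CompactSpace (levelSet ξ) := isCompact_iff_compactSpace.1 hc
  obtain ⟨t, ht⟩ := isCompact_univ.elim_finite_subcover (fun y => φ y '' O y) hop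
    fun y _ => Set.mem_iUnion.2 ⟨y, hy y⟩
  calc surfaceMeasure ξ Set.univ ≤ surfaceMeasure ξ (⋃ y ∈ t, φ y '' O y) := measure_mono ht
    _ ≤ ∑ y ∈ t, surfaceMeasure ξ (φ y '' O y) := measure_biUnion_finset_le _ _
    _ < ⊤ := by
      refine ENNReal.sum_lt_top.2 fun y _ => ?_
      rw [surfaceMeasure_apply_of_subset hkd hξ hU (hφ y) (hφ y).measurableSet_image
        subset_rfl]
      exact (measure_mono (Set.subset_univ _)).trans_lt (hfin y)

/-- Area formula for an affine map which is injective on a subset of `Σ`. -/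
theorem volume_image_eq_setLIntegral [Nonempty (levelSet ξ)] (hkd : k ≤ d)
    (hξ : ContDiff ℝ ∞ ξ) (hU : IsTangentFrame ξ U) (L : Eu d →L[ℝ] Eu (d - k))
    (b : Eu (d - k)) {A : Set (levelSet ξ)} (hA : MeasurableSet A)
    (hinj : Set.InjOn (fun y : levelSet ξ => L (y : Eu d) + b) A) :
    volume ((fun y : levelSet ξ => L (y : Eu d) + b) '' A)
      = ∫⁻ y in A, ENNReal.ofReal (tangentJac U L y) ∂(surfaceMeasure ξ) := by
  have hξd : Differentiable ℝ ξ := hξ.differentiable (by simp)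
  obtain ⟨O, φ, -, hφ, -, hcov⟩ := exists_chart_cover hkd hξ hU
  have : PolishSpace (levelSet ξ) := (isClosed_levelSet hξ.continuous).polishSpace
  set B : ℕ → Set (levelSet ξ) := disjointed fun i => φ i '' O i with hB
  have hBm : ∀ i, MeasurableSet (B i) :=
    MeasurableSet.disjointed fun i => (hφ i).measurableSet_image
  have hBsub : ∀ i, B i ⊆ φ i '' O i := disjointed_subset _
  have hBd : Pairwise (Function.onFun Disjoint B) := disjoint_disjointed _
  have hA' : A = ⋃ i, A ∩ B i := by
    rw [← Set.inter_iUnion, hB, iUnion_disjointed, hcov, Set.inter_univ]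
  have hd : Pairwise (Function.onFun Disjoint fun i => A ∩ B i) := fun i j hij =>
    (hBd hij).mono Set.inter_subset_right Set.inter_subset_right
  have hcont : Continuous fun y : levelSet ξ => L (y : Eu d) + b := by fun_prop
  rw [hA', Set.image_iUnion, measure_iUnion, lintegral_iUnion (fun i => hA.inter (hBm i)) hd]
  · refine tsum_congr fun i => ?_
    rw [(hφ i).volume_image hξd hU L b (hA.inter (hBm i))
      (Set.inter_subset_right.trans (hBsub i)) (hinj.mono Set.inter_subset_left)]
    congr 1
    ext E hE
    rw [Measure.restrict_apply hE, Measure.restrict_apply hE,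
      surfaceMeasure_apply_of_subset hkd hξ hU (hφ i) (hE.inter (hA.inter (hBm i)))
        (Set.inter_subset_right.trans (Set.inter_subset_right.trans (hBsub i)))]
  · intro i j hij
    refine Set.disjoint_left.2 ?_
    rintro _ ⟨y, hy, rfl⟩ ⟨z, hz, hyz⟩
    rw [hinj hz.1 hy.1 hyz] at hz
    exact Set.disjoint_left.1 (hBd hij) hy.2 hz.2
  · exact fun i => (hA.inter (hBm i)).image_of_continuousOn_injOn hcont.continuousOn
      (hinj.mono Set.inter_subset_left)

/-- The critical values of an affine map on `Σ` are negligible. -/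
theorem volume_image_critical_eq_zero [Nonempty (levelSet ξ)] (hkd : k ≤ d)
    (hξ : ContDiff ℝ ∞ ξ) (hU : IsTangentFrame ξ U) (L : Eu d →L[ℝ] Eu (d - k))
    (b : Eu (d - k)) :
    volume ((fun y : levelSet ξ => L (y : Eu d) + b) '' {y | tangentJac U L y = 0}) = 0 := by
  have hξd : Differentiable ℝ ξ := hξ.differentiable (by simp)
  obtain ⟨O, φ, -, hφ, -, hcov⟩ := exists_chart_cover hkd hξ hU
  have : {y | tangentJac U L y = 0} = ⋃ i, {y | tangentJac U L y = 0} ∩ φ i '' O i := by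
    rw [← Set.inter_iUnion, hcov, Set.inter_univ]
  rw [this, Set.image_iUnion]
  exact measure_iUnion_null fun i => (hφ i).volume_image_eq_zero hξd hU L b
    Set.inter_subset_right fun y hy => hy.1

theorem surfaceMeasure_ne_zero [Nonempty (levelSet ξ)] (hkd : k ≤ d)
    (hξ : ContDiff ℝ ∞ ξ) (hU : IsTangentFrame ξ U) : surfaceMeasure ξ Set.univ ≠ 0 := by
  obtain ⟨y⟩ := ‹Nonempty (levelSet ξ)›
  have : Nonempty (levelSet ξ) := ⟨y⟩
  obtain ⟨O, φ, hφ, hL, ⟨v, hv, -⟩, -⟩ := exists_chart_inverse hkd hξ hU (actL (U y)ᵀ) y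
    (by rw [tangentJac_transpose_self hU]; exact one_ne_zero)
  intro h0
  have hinj := injOn_image_of_inverse hL
  have h1 := volume_image_eq_setLIntegral hkd hξ hU (actL (U y)ᵀ) 0 hφ.measurableSet_image
    (by simpa only [add_zero] using hinj)
  rw [Measure.measure_univ_eq_zero.1 h0, Measure.restrict_zero, lintegral_zero_measure] at h1
  simp only [add_zero] at h1
  have h2 : (fun z : levelSet ξ => actL (U y)ᵀ (z : Eu d)) '' (φ '' O) = O := by
    rw [Set.image_image]
    exact (Set.image_congr hL).trans (Set.image_id' _)
  rw [h2] at h1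
  exact (hφ.isOpen.measure_pos volume ⟨v, hv⟩).ne' h1

/-- The regular points of a linear map on `Σ` split into countably many measurable pieces on
each of which the map is injective. -/
lemma exists_injOn_partition (hkd : k ≤ d) (hξ : ContDiff ℝ ∞ ξ) (hU : IsTangentFrame ξ U)
    (L : Eu d →L[ℝ] Eu (d - k)) :
    ∃ B : ℕ → Set (levelSet ξ), (∀ i, MeasurableSet (B i)) ∧
      Pairwise (Function.onFun Disjoint B) ∧ ⋃ i, B i = {y | tangentJac U L y ≠ 0} ∧
      ∀ i, Set.InjOn (fun y : levelSet ξ => L (y : Eu d)) (B i) := by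
  have hξd : Differentiable ℝ ξ := hξ.differentiable (by simp)
  have h1 (y : {y : levelSet ξ // tangentJac U L y ≠ 0}) :=
    exists_chart_inverse hkd hξ hU L y y.2
  choose O φ hφ hL hy hop using h1
  obtain ⟨T, hT, hcov⟩ := TopologicalSpace.isOpen_iUnion_countable _ hop
  have hU' : ⋃ y ∈ T, φ y '' O y = {y | tangentJac U L y ≠ 0} := by
    rw [hcov]
    refine Set.Subset.antisymm (Set.iUnion_subset fun y z hz =>
      (hφ y).tangentJac_ne_zero hξd hU (hL y) hz) fun y hy' => ?_
    exact Set.mem_iUnion.2 ⟨⟨y, hy'⟩, hy ⟨y, hy'⟩⟩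
  rcases T.eq_empty_or_nonempty with rfl | hne
  · refine ⟨fun _ => ∅, fun _ => MeasurableSet.empty, fun i j _ => disjoint_bot_left, ?_,
      fun _ => Set.injOn_empty _⟩
    rw [← hU']; simp
  · obtain ⟨a, rfl⟩ := hT.exists_eq_range hne
    refine ⟨disjointed fun i => φ (a i) '' O (a i),
      MeasurableSet.disjointed fun i => (hφ (a i)).measurableSet_image,
      disjoint_disjointed _, ?_, fun i => ?_⟩
    · rw [iUnion_disjointed, ← hU', Set.biUnion_range]
    · exact (injOn_image_of_inverse (hL (a i))).mono (disjointed_subset _ _)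

end Gluing

section Fibre

variable {X E : Type*}

lemma injective_restrict {G : X → E} {B : Set X} (hinj : Set.InjOn G B) :
    Function.Injective fun y : B => G y := fun y z h => Subtype.ext (hinj y.2 z.2 h)

variable [MeasurableSpace X]

open Classical in
/-- The counting measure on the fibre `G⁻¹(v)`, weighted by `g`. -/
def fibre (G : X → E) (g : X → ENNReal) (v : E) : Measure X :=
  Measure.sum fun y => (if G y = v then g y else 0) • Measure.dirac y

/-- The part in `B` of the weighted counting measure on the fibre `G⁻¹(v)`, when `G` is
injective on `B`. -/
def fibrePart (G : X → E) (g : X → ENNReal) (B : Set X) : E → Measure X :=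
  Function.extend (fun y : B => G y) (fun y : B => g y • Measure.dirac (y : X)) 0

open Classical in
lemma fibre_apply (G : X → E) (g : X → ENNReal) (v : E) {S : Set X} (hS : MeasurableSet S) :
    fibre G g v S = ∑' y, if G y = v then g y * S.indicator 1 y else 0 := by
  rw [fibre, Measure.sum_apply _ hS]
  refine tsum_congr fun y => ?_
  by_cases h : G y = v <;> simp [h, Measure.dirac_apply' _ hS]

lemma fibrePart_apply {G : X → E} (g : X → ENNReal) {B : Set X} (hinj : Set.InjOn G B) (v : E)
    {S : Set X} (hS : MeasurableSet S) : fibrePart G g B v S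
      = Function.extend (fun y : B => G y) (fun y : B => g y * S.indicator 1 (y : X)) 0 v := by
  rw [fibrePart]
  by_cases h : ∃ y : B, G y = v
  · obtain ⟨y, rfl⟩ := h
    have e1 := (injective_restrict hinj).extend_apply
      (fun y : B => g y • Measure.dirac (y : X)) 0 y
    have e2 := (injective_restrict hinj).extend_apply
      (fun y : B => g y * S.indicator 1 (y : X)) 0 y
    rw [e1, e2]
    simp [Measure.dirac_apply' _ hS]
  · rw [Function.extend_apply' _ _ _ h, Function.extend_apply' _ _ _ h]
    simp

lemma fibre_eq_sum_fibrePart {G : X → E} (g : X → ENNReal) {B : ℕ → Set X}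
    (hBd : Pairwise (Function.onFun Disjoint B)) (hinj : ∀ i, Set.InjOn G (B i)) {v : E}
    (hv : ∀ y, G y = v → y ∈ ⋃ i, B i) :
    fibre G g v = Measure.sum fun i => fibrePart G g (B i) v := by
  classical
  ext S hS
  rw [fibre_apply _ _ _ hS, Measure.sum_apply _ hS]
  have h1 (y : X) : (if G y = v then g y * S.indicator 1 y else 0)
      = ∑' i, if y ∈ B i ∧ G y = v then g y * S.indicator 1 y else 0 := by
    by_cases hy : G y = v
    · obtain ⟨i, hi⟩ := Set.mem_iUnion.1 (hv y hy)
      rw [tsum_eq_single i, if_pos hy, if_pos ⟨hi, hy⟩]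
      intro j hj
      exact if_neg fun h => Set.disjoint_left.1 (hBd hj) h.1 hi
    · simp [hy]
  simp_rw [h1]
  rw [ENNReal.tsum_comm]
  refine tsum_congr fun i => ?_
  rw [fibrePart_apply g (hinj i) v hS]
  by_cases h : ∃ y : B i, G y = v
  · obtain ⟨y, rfl⟩ := h
    have e2 := (injective_restrict (hinj i)).extend_apply
      (fun y : B i => g y * S.indicator 1 (y : X)) 0 y
    rw [e2, tsum_eq_single (y : X), if_pos ⟨y.2, rfl⟩]
    intro z hz
    exact if_neg fun h => hz (hinj i h.1 y.2 h.2)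
  · rw [Function.extend_apply' _ _ _ h, Pi.zero_apply, ENNReal.tsum_eq_zero]
    exact fun y => if_neg fun hy => h ⟨⟨y, hy.1⟩, hy.2⟩

variable [MeasurableSpace E] [StandardBorelSpace X] [MeasurableSpace.CountablySeparated E]

lemma measurableEmbedding_restrict {G : X → E} (hG : Measurable G) {B : Set X}
    (hB : MeasurableSet B) (hinj : Set.InjOn G B) :
    MeasurableEmbedding fun y : B => G y := by
  have := hB.standardBorel
  exact (hG.comp measurable_subtype_coe).measurableEmbedding (injective_restrict hinj)

lemma measurable_fibrePart_coe {G : X → E} (hG : Measurable G) {g : X → ENNReal}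
    (hg : Measurable g) {B : Set X} (hB : MeasurableSet B) (hinj : Set.InjOn G B) {S : Set X}
    (hS : MeasurableSet S) : Measurable fun v => fibrePart G g B v S := by
  simp_rw [fibrePart_apply g hinj _ hS]
  exact (measurableEmbedding_restrict hG hB hinj).measurable_extend
    ((hg.mul (measurable_one.indicator hS)).comp measurable_subtype_coe) measurable_zero

lemma lintegral_fibrePart {G : X → E} (hG : Measurable G) (g : X → ENNReal)
    {B : Set X} (hB : MeasurableSet B) (hinj : Set.InjOn G B)
    {μ : Measure X} {vol : Measure E}
    (harea : ∀ A ⊆ B, MeasurableSet A → vol (G '' A) = μ A) {S : Set X} (hS : MeasurableSet S) :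
    ∫⁻ v, fibrePart G g B v S ∂vol = ∫⁻ y in B, g y * S.indicator 1 y ∂μ := by
  have hemb := measurableEmbedding_restrict hG hB hinj
  have hcomap : Measure.comap (fun y : B => G y) vol = Measure.comap Subtype.val μ := by
    ext A hA
    rw [hemb.comap_apply, (MeasurableEmbedding.subtype_coe hB).comap_apply,
      ← harea _ (by rintro _ ⟨y, -, rfl⟩; exact y.2) (hB.subtype_image hA), Set.image_image]
  rw [← lintegral_subtype_comap hB, ← hcomap]
  have h1 : ∫⁻ v, fibrePart G g B v S ∂vol
      = ∫⁻ v in Set.range fun y : B => G y, fibrePart G g B v S ∂vol := by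
    refine (setLIntegral_eq_of_support_subset ?_).symm
    intro v hv
    by_contra hr
    apply hv
    dsimp only
    rw [fibrePart_apply g hinj v hS, Function.extend_apply' _ _ _ hr, Pi.zero_apply]
  rw [h1, ← hemb.map_comap, hemb.lintegral_map]
  refine lintegral_congr fun y => ?_
  rw [fibrePart_apply g hinj _ hS]
  exact hemb.injective.extend_apply _ _ y

/-- If `G` is injective on countably many pieces covering almost every fibre, the weighted counting
measure on the fibres of `G` depends measurably on the base point. -/
lemma aemeasurable_fibre {G : X → E} (hG : Measurable G) {g : X → ENNReal} (hg : Measurable g)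
    {B : ℕ → Set X} (hBm : ∀ i, MeasurableSet (B i)) (hBd : Pairwise (Function.onFun Disjoint B))
    (hinj : ∀ i, Set.InjOn G (B i)) {vol : Measure E} (hnull : vol (G '' (⋃ i, B i)ᶜ) = 0) :
    AEMeasurable (fibre G g) vol := by
  refine ⟨fun v => Measure.sum fun i => fibrePart G g (B i) v, ?_, ?_⟩
  · refine Measure.measurable_of_measurable_coe _ fun S hS => ?_
    simp_rw [Measure.sum_apply _ hS]
    exact Measurable.tsum fun i => measurable_fibrePart_coe hG hg (hBm i) (hinj i) hS
  · filter_upwards [measure_eq_zero_iff_ae_notMem.1 hnull] with v hv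
    refine fibre_eq_sum_fibrePart g hBd hinj fun y hy => ?_
    by_contra h
    exact hv ⟨y, h, hy⟩

/-- Area formula for the weighted counting measures on the fibres of `G`. -/
lemma lintegral_fibre {G : X → E} (hG : Measurable G) {g : X → ENNReal} (hg : Measurable g)
    {B : ℕ → Set X} (hBm : ∀ i, MeasurableSet (B i)) (hBd : Pairwise (Function.onFun Disjoint B))
    (hinj : ∀ i, Set.InjOn G (B i)) {μ : Measure X} {vol : Measure E}
    (hnull : vol (G '' (⋃ i, B i)ᶜ) = 0) (hμ : μ (⋃ i, B i)ᶜ = 0)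
    (harea : ∀ A, MeasurableSet A → Set.InjOn G A → vol (G '' A) = μ A)
    {S : Set X} (hS : MeasurableSet S) :
    ∫⁻ v, fibre G g v S ∂vol = ∫⁻ y in S, g y ∂μ := by
  have h1 : ∀ᵐ v ∂vol, fibre G g v S = ∑' i, fibrePart G g (B i) v S := by
    filter_upwards [measure_eq_zero_iff_ae_notMem.1 hnull] with v hv
    rw [fibre_eq_sum_fibrePart g hBd hinj fun y hy => ?_, Measure.sum_apply _ hS]
    by_contra h
    exact hv ⟨y, h, hy⟩
  rw [lintegral_congr_ae h1, lintegral_tsum fun i =>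
    (measurable_fibrePart_coe hG hg (hBm i) (hinj i) hS).aemeasurable]
  calc ∑' i, ∫⁻ v, fibrePart G g (B i) v S ∂vol
      = ∑' i, ∫⁻ y in B i, g y * S.indicator 1 y ∂μ := tsum_congr fun i =>
        lintegral_fibrePart hG g (hBm i) (hinj i)
          (fun A hA hAm => harea A hAm ((hinj i).mono hA)) hS
    _ = ∫⁻ y in ⋃ i, B i, g y * S.indicator 1 y ∂μ := (lintegral_iUnion hBm hBd _).symm
    _ = ∫⁻ y, g y * S.indicator 1 y ∂μ := by
        rw [Measure.restrict_eq_self_of_ae_mem (measure_eq_zero_iff_ae_notMem.1 hμ |>.mono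
          fun y hy => not_not.1 hy)]
    _ = ∫⁻ y in S, g y ∂μ := by
        rw [← lintegral_indicator hS]
        refine lintegral_congr fun y => ?_
        by_cases hy : y ∈ S <;> simp [hy]

end Fibre

section Proposal

variable {d k : ℕ} {ξ : Eu d → Eu k} {V Vb : Eu d → ℝ} {β τ : ℝ}
  {U : levelSet ξ → Matrix (Fin d) (Fin (d - k)) ℝ}
  {Ψ : levelSet ξ → Eu (d - k) → Set (levelSet ξ)}
  {sel : levelSet ξ → levelSet ξ → Eu (d - k) → ℝ}

/-- The linear part of the velocity map. -/
def velocityLin (τ : ℝ) (U : levelSet ξ → Matrix (Fin d) (Fin (d - k)) ℝ) (x : levelSet ξ) :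
    Eu d →L[ℝ] Eu (d - k) := (1 / Real.sqrt (2 * τ)) • actL (U x)ᵀ

lemma velocity_eq (Vb : Eu d → ℝ) (τ : ℝ) (U : levelSet ξ → Matrix (Fin d) (Fin (d - k)) ℝ)
    (x y : levelSet ξ) : velocity ξ Vb τ U x y
      = velocityLin τ U x (y : Eu d) + velocityLin τ U x (τ • gradient Vb x - x) := by
  rw [← map_add, velocity, velocityLin, _root_.smul_apply, actL_apply]
  congr 2
  abel

lemma IsTangentFrame.act_transpose_grad (hU : IsTangentFrame ξ U) (x : levelSet ξ) (c : Eu k) :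
    act (U x)ᵀ (act (grad ξ x) c) = 0 := by
  have h1 : (grad ξ x)ᵀ * U x = 0 := by
    ext i j
    have := (hU.range_eq x _).2 ⟨EuclideanSpace.single j 1, rfl⟩
    rw [← act_mul] at this
    rw [← act_single ((grad ξ x)ᵀ * U x) j i, this]; rfl
  have h2 : (U x)ᵀ * grad ξ x = 0 := by
    have := congrArg Matrix.transpose h1
    simpa using this
  rw [← act_mul, h2]
  simp [act]

lemma velocity_eq_of_mem (hτ : 0 < τ) (hU : IsTangentFrame ξ U)
    (hΨ : ProjectionAssumption ξ Vb τ U Ψ) {x y : levelSet ξ} {v : Eu (d - k)} (hy : y ∈ Ψ x v) :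
    velocity ξ Vb τ U x y = v := by
  obtain ⟨c, hc⟩ := hΨ.subset x v hy
  have h1 : (y : Eu d) - x + τ • gradient Vb x
      = Real.sqrt (2 * τ) • act (U x) v + act (grad ξ x) c := by
    rw [hc, move]; abel
  have h2 : Real.sqrt (2 * τ) ≠ 0 := (Real.sqrt_pos.2 (by positivity)).ne'
  rw [velocity, h1, ← actL_apply (U x)ᵀ, map_add, map_smul, actL_apply, actL_apply,
    hU.act_transpose_grad, hU.act_transpose_act, add_zero, smul_smul, one_div,
    inv_mul_cancel₀ h2, one_smul]

lemma mem_imPsi_iff (hτ : 0 < τ) (hU : IsTangentFrame ξ U)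
    (hΨ : ProjectionAssumption ξ Vb τ U Ψ) {x y : levelSet ξ} :
    y ∈ imPsi ξ Ψ x ↔ y ∈ Ψ x (velocity ξ Vb τ U x y) := by
  constructor
  · rintro ⟨v, hv⟩
    rwa [velocity_eq_of_mem hτ hU hΨ hv]
  · exact fun h => ⟨_, h⟩

open Classical in
/-- The probability that the point `y` is proposed and accepted, given that the velocity drawn at
`x` is the one that leads to `y`; zero if `(x, y)` is not admissible. -/
def moveProb (ξ : Eu d → Eu k) (V Vb : Eu d → ℝ) (β τ : ℝ)
    (U : levelSet ξ → Matrix (Fin d) (Fin (d - k)) ℝ)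
    (Ψ : levelSet ξ → Eu (d - k) → Set (levelSet ξ))
    (sel : levelSet ξ → levelSet ξ → Eu (d - k) → ℝ) (x y : levelSet ξ) : ENNReal :=
  if (x, y) ∈ admissibleSet ξ Ψ then
    ENNReal.ofReal (sel y x (velocity ξ Vb τ U x y))
      * ENNReal.ofReal (acceptProb ξ V Vb β τ U sel y x)
  else 0

lemma acceptProb_le_one (x y : levelSet ξ) : acceptProb ξ V Vb β τ U sel y x ≤ 1 :=
  min_le_left _ _

lemma map_uniform_ite {X : Type*} [MeasurableSpace X] (x y : X) {a : ℝ}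
    (ha1 : a ≤ 1) [DecidablePred fun r : ℝ => r ≤ a] :
    (volume.restrict (Set.Icc (0 : ℝ) 1)).map (fun r => if r ≤ a then y else x)
      = ENNReal.ofReal a • Measure.dirac y + (1 - ENNReal.ofReal a) • Measure.dirac x := by
  have hm : Measurable fun r : ℝ => if r ≤ a then y else x :=
    Measurable.ite measurableSet_Iic measurable_const measurable_const
  have hI : MeasurableSet {r : ℝ | r ≤ a} := measurableSet_Iic
  ext S hS
  have h1 : volume.restrict (Set.Icc (0 : ℝ) 1) {r | r ≤ a} = ENNReal.ofReal a := by
    rw [Measure.restrict_apply hI]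
    have : {r : ℝ | r ≤ a} ∩ Set.Icc 0 1 = Set.Icc 0 a := by
      ext r; simp only [Set.mem_inter_iff, Set.mem_ofPred_eq, Set.mem_Icc]
      constructor
      · rintro ⟨h1, h2, -⟩; exact ⟨h2, h1⟩
      · rintro ⟨h1, h2⟩; exact ⟨h2, h1, h2.trans ha1⟩
    rw [this, Real.volume_Icc, sub_zero]
  have h2 : volume.restrict (Set.Icc (0 : ℝ) 1) {r | ¬ r ≤ a} = 1 - ENNReal.ofReal a := by
    rw [← Set.compl_ofPred, measure_compl hI (by rw [h1]; exact ENNReal.ofReal_ne_top), h1]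
    simp
  rw [Measure.map_apply hm hS]
  have hpre : (fun r : ℝ => if r ≤ a then y else x) ⁻¹' S
      = {r | r ≤ a ∧ y ∈ S} ∪ {r | ¬ r ≤ a ∧ x ∈ S} := by
    ext r
    by_cases hr : r ≤ a
    · simp [hr]
    · simp only [Set.mem_preimage, hr, if_false, Set.mem_union, Set.mem_ofPred_eq, false_and,
        false_or, not_false_eq_true, true_and]
  have hdisj : Disjoint {r | r ≤ a ∧ y ∈ S} {r | ¬ r ≤ a ∧ x ∈ S} :=
    Set.disjoint_left.2 fun r h h' => h'.1 h.1
  rw [hpre, measure_union hdisj (by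
    by_cases hx : x ∈ S
    · simp only [hx, and_true]
      exact hI.compl
    · simp [hx])]
  simp only [Measure.add_apply, Measure.smul_apply, smul_eq_mul, Measure.dirac_apply' _ hS]
  congr 1
  · by_cases hy : y ∈ S
    · simpa [hy] using h1
    · simp [hy]
  · by_cases hx : x ∈ S
    · simpa only [hx, and_true, Set.indicator_of_mem, Pi.one_apply, mul_one] using h2
    · simp [hx]

lemma acceptProb_nonneg (hτ : 0 < τ) (hU : IsTangentFrame ξ U)
    (hΨ : ProjectionAssumption ξ Vb τ U Ψ) (hsel : IsSelectionProbability ξ Ψ sel)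
    {x y : levelSet ξ} (h : (x, y) ∈ admissibleSet ξ Ψ) :
    0 ≤ acceptProb ξ V Vb β τ U sel y x :=
  le_min zero_le_one (mul_nonneg (div_nonneg
    (hsel.pos _ _ _ ((mem_imPsi_iff hτ hU hΨ).1 h.2)).le
    (hsel.pos _ _ _ ((mem_imPsi_iff hτ hU hΨ).1 h.1)).le) (Real.exp_nonneg _))

lemma stepGivenProposal_eq (hτ : 0 < τ) (hU : IsTangentFrame ξ U)
    (hΨ : ProjectionAssumption ξ Vb τ U Ψ)
    {x y : levelSet ξ} {v : Eu (d - k)} (hy : y ∈ Ψ x v) :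
    ENNReal.ofReal (sel y x v) • stepGivenProposal ξ V Vb β τ U Ψ sel x y
      = moveProb ξ V Vb β τ U Ψ sel x y • Measure.dirac y
        + (ENNReal.ofReal (sel y x v) - moveProb ξ V Vb β τ U Ψ sel x y) • Measure.dirac x := by
  have hv := velocity_eq_of_mem hτ hU hΨ hy
  have hadm : (x, y) ∈ admissibleSet ξ Ψ ↔ x ∈ Ψ y (velocity ξ Vb τ U y x) := by
    rw [← mem_imPsi_iff hτ hU hΨ]
    exact ⟨fun h => h.2, fun h => ⟨⟨v, hy⟩, h⟩⟩
  by_cases h : (x, y) ∈ admissibleSet ξ Ψ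
  · rw [stepGivenProposal, if_pos (hadm.1 h), moveProb, if_pos h, hv,
      map_uniform_ite x y (acceptProb_le_one x y),
      smul_add, smul_smul, smul_smul, ENNReal.mul_sub (fun _ _ => ENNReal.ofReal_ne_top),
      mul_one]
  · rw [stepGivenProposal, if_neg (fun h' => h (hadm.2 h')), moveProb, if_neg h]
    simp

lemma moveProb_le (hτ : 0 < τ) (hU : IsTangentFrame ξ U)
    (hΨ : ProjectionAssumption ξ Vb τ U Ψ)
    {x y : levelSet ξ} {v : Eu (d - k)} (hy : y ∈ Ψ x v) :
    moveProb ξ V Vb β τ U Ψ sel x y ≤ ENNReal.ofReal (sel y x v) := by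
  rw [moveProb]
  split_ifs with h
  · rw [velocity_eq_of_mem hτ hU hΨ hy]
    exact mul_le_of_le_one_right' (ENNReal.ofReal_le_one.2 (acceptProb_le_one x y))
  · exact zero_le

lemma tsum_sel_eq_one (hΨ : ProjectionAssumption ξ Vb τ U Ψ)
    (hsel : IsSelectionProbability ξ Ψ sel) {x : levelSet ξ} {v : Eu (d - k)}
    (hne : (Ψ x v).Nonempty) : ∑' y : Ψ x v, ENNReal.ofReal (sel y x v) = 1 := by
  have hfin := hΨ.finite x v
  have := hfin.fintype
  rw [tsum_fintype, ← ENNReal.ofReal_sum_of_nonneg fun y _ => (hsel.pos x v _ (Subtype.coe_prop y)).le,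
    ← ENNReal.ofReal_one, ← hsel.sum_eq_one x v hne,
    finsum_mem_eq_finite_toFinset_sum _ hfin]
  congr 1
  refine Finset.sum_bij (fun y _ => (y : levelSet ξ)) (fun y _ => by simp)
    (fun y _ z _ h => Subtype.ext h) (fun y hy => ⟨⟨y, by simpa using hy⟩, by simp, rfl⟩)
    (fun y _ => rfl)

lemma fibre_velocity_eq (hτ : 0 < τ) (hU : IsTangentFrame ξ U)
    (hΨ : ProjectionAssumption ξ Vb τ U Ψ) (x : levelSet ξ) (v : Eu (d - k)) :
    fibre (velocity ξ Vb τ U x) (moveProb ξ V Vb β τ U Ψ sel x) v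
      = Measure.sum fun y : Ψ x v => moveProb ξ V Vb β τ U Ψ sel x y
          • Measure.dirac (y : levelSet ξ) := by
  classical
  ext S hS
  rw [fibre_apply _ _ _ hS, Measure.sum_apply _ hS]
  simp only [Measure.smul_apply, smul_eq_mul, Measure.dirac_apply' _ hS]
  rw [tsum_subtype (Ψ x v) fun y => moveProb ξ V Vb β τ U Ψ sel x y * S.indicator 1 y]
  refine tsum_congr fun y => ?_
  by_cases hy : y ∈ Ψ x v
  · rw [Set.indicator_of_mem hy, if_pos (velocity_eq_of_mem hτ hU hΨ hy)]
  · rw [Set.indicator_of_notMem hy]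
    split_ifs with hv
    · rw [moveProb, if_neg, zero_mul]
      intro h
      have := (mem_imPsi_iff hτ hU hΨ).1 h.1
      rw [hv] at this
      exact hy this
    · rfl

lemma fibre_velocity_univ_le_one (hτ : 0 < τ) (hU : IsTangentFrame ξ U)
    (hΨ : ProjectionAssumption ξ Vb τ U Ψ) (hsel : IsSelectionProbability ξ Ψ sel)
    (x : levelSet ξ) (v : Eu (d - k)) :
    fibre (velocity ξ Vb τ U x) (moveProb ξ V Vb β τ U Ψ sel x) v Set.univ ≤ 1 := by
  rw [fibre_velocity_eq hτ hU hΨ, Measure.sum_apply _ MeasurableSet.univ]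
  simp only [Measure.smul_apply, smul_eq_mul, measure_univ, mul_one]
  rcases (Ψ x v).eq_empty_or_nonempty with h | h
  · have : IsEmpty (Ψ x v) := Set.isEmpty_coe_sort.2 h
    simp
  · rw [← tsum_sel_eq_one hΨ hsel h]
    exact ENNReal.tsum_le_tsum fun y => moveProb_le hτ hU hΨ y.2

lemma stepGivenVelocity_eq (hτ : 0 < τ) (hU : IsTangentFrame ξ U)
    (hΨ : ProjectionAssumption ξ Vb τ U Ψ) (hsel : IsSelectionProbability ξ Ψ sel)
    (x : levelSet ξ) (v : Eu (d - k)) :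
    stepGivenVelocity ξ V Vb β τ U Ψ sel x v
      = fibre (velocity ξ Vb τ U x) (moveProb ξ V Vb β τ U Ψ sel x) v
        + (1 - fibre (velocity ξ Vb τ U x) (moveProb ξ V Vb β τ U Ψ sel x) v Set.univ)
          • Measure.dirac x := by
  have hle := fibre_velocity_univ_le_one (V := V) (β := β) hτ hU hΨ hsel x v
  rw [fibre_velocity_eq hτ hU hΨ] at hle ⊢
  rw [Measure.sum_apply _ MeasurableSet.univ] at hle ⊢
  simp only [Measure.smul_apply, smul_eq_mul, measure_univ, mul_one] at hle ⊢
  rw [stepGivenVelocity]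
  split_ifs with h
  · have : IsEmpty (Ψ x v) := Set.isEmpty_coe_sort.2 h
    simp
  · simp_rw [fun y : Ψ x v => stepGivenProposal_eq (V := V) (β := β) (sel := sel) hτ hU hΨ y.2]
    have hsub : ∑' y : Ψ x v, (ENNReal.ofReal (sel y x v) - moveProb ξ V Vb β τ U Ψ sel x y)
        = ∑' y : Ψ x v, ENNReal.ofReal (sel y x v)
          - ∑' y : Ψ x v, moveProb ξ V Vb β τ U Ψ sel x y := by
      refine ENNReal.eq_sub_of_add_eq (ne_top_of_le_ne_top ENNReal.one_ne_top hle) ?_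
      rw [← ENNReal.tsum_add]
      exact tsum_congr fun y => tsub_add_cancel_of_le (moveProb_le hτ hU hΨ y.2)
    ext S hS
    rw [Measure.add_apply, Measure.sum_apply _ hS, Measure.sum_apply _ hS]
    simp only [Measure.add_apply, Measure.smul_apply, smul_eq_mul]
    rw [ENNReal.tsum_add, ENNReal.tsum_mul_right,
      hsub, tsum_sel_eq_one hΨ hsel (Set.nonempty_iff_ne_empty.2 h)]

end Proposal

section Reversibility

lemma isProbabilityMeasure_gaussian {β : ℝ} (hβ : 0 < β) (n : ℕ) : IsProbabilityMeasure (gaussian β n) := by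
  refine ⟨?_⟩
  have hval : ∫ v : Eu n, Real.exp (-β * ‖v‖ ^ 2 / 2) = (2 * Real.pi / β) ^ ((n : ℝ) / 2) := by
    have := GaussianFourier.integral_rexp_neg_mul_sq_norm (V := Eu n) (half_pos hβ)
    rw [finrank_euclideanSpace_fin] at this
    rw [show 2 * Real.pi / β = Real.pi / (β / 2) by field_simp, ← this]
    congr 1 with v
    congr 1; ring
  have hpos : 0 < 2 * Real.pi / β := by positivity
  have hint : Integrable (fun v : Eu n => Real.exp (-β * ‖v‖ ^ 2 / 2)) := by
    by_contra h
    rw [integral_undef h] at hval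
    exact (Real.rpow_pos_of_pos hpos _).ne hval
  rw [gaussian, withDensity_apply _ MeasurableSet.univ, Measure.restrict_univ,
    ← ofReal_integral_eq_lintegral_ofReal (hint.const_mul _)
      (Filter.Eventually.of_forall fun v => by positivity),
    integral_const_mul, hval, ← Real.rpow_add hpos]
  rw [show -(n : ℝ) / 2 + n / 2 = 0 by ring, Real.rpow_zero, ENNReal.ofReal_one]

lemma measurable_act {α : Type*} [MeasurableSpace α] {m n : ℕ}
    {A : α → Matrix (Fin m) (Fin n) ℝ} {v : α → Eu n} (hA : ∀ i j, Measurable fun a => A a i j)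
    (hv : Measurable v) : Measurable fun a => act (A a) (v a) := by
  refine (WithLp.measurable_toLp 2 _).comp (measurable_pi_lambda _ fun i => ?_)
  simp only [Matrix.mulVec, dotProduct]
  exact Finset.measurable_fun_sum _ fun j _ => (hA i j).mul
    ((measurable_pi_apply j).comp ((WithLp.measurable_ofLp 2 _).comp hv))

/-- The density of the Gaussian measure. -/
def gaussianDensity (β : ℝ) (n : ℕ) (v : Eu n) : ℝ :=
  (2 * Real.pi / β) ^ (-(n : ℝ) / 2) * Real.exp (-β * ‖v‖ ^ 2 / 2)

lemma gaussian_eq_withDensity (β : ℝ) (n : ℕ) :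
    gaussian β n = volume.withDensity fun v => ENNReal.ofReal (gaussianDensity β n v) := rfl

lemma measurable_gaussianDensity (β : ℝ) (n : ℕ) : Measurable (gaussianDensity β n) := by
  unfold gaussianDensity; fun_prop

lemma mul_min_one_div {p q : ℝ} (hp : 0 < p) : p * min 1 (q / p) = min p q := by
  rw [mul_min_of_nonneg _ _ hp.le, mul_one, mul_div_cancel₀ _ hp.ne']

/-- A chain whose kernel satisfies detailed balance on measurable sets is reversible. -/
lemma isReversibleChain_of_isReversible {X : Type*} [MeasurableSpace X] {q : Kernel X X}
    [IsMarkovKernel q] {ν : Measure X} [IsFiniteMeasure ν] (h : q.IsReversible ν) :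
    IsReversibleChain q ν := by
  have hswap : (ν ⊗ₘ q).map Prod.swap = ν ⊗ₘ q := by
    refine Measure.ext_prod fun {s t} hs ht => ?_
    rw [Measure.map_apply measurable_swap (hs.prod ht), Set.preimage_swap_prod,
      Measure.compProd_apply_prod ht hs, Measure.compProd_apply_prod hs ht]
    exact h ht hs
  rintro f hf ⟨C, hC⟩
  have hint {g : X × X → ℝ} (hg : Measurable g) (hgC : ∀ p, |g p| ≤ C) :
      Integrable g (ν ⊗ₘ q) :=
    Integrable.of_bound hg.aestronglyMeasurable C (Filter.Eventually.of_forall hgC)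
  rw [← Measure.integral_compProd (hint hf hC),
    ← Measure.integral_compProd (f := fun p => f (p.2, p.1))
      (hint (hf.comp measurable_swap) fun p => hC _)]
  conv_lhs => rw [← hswap]
  rw [integral_map measurable_swap.aemeasurable hf.aestronglyMeasurable]
  rfl

variable {d k : ℕ} {ξ : Eu d → Eu k} {V Vb : Eu d → ℝ} {β τ : ℝ}
  {U : levelSet ξ → Matrix (Fin d) (Fin (d - k)) ℝ}
  {Ψ : levelSet ξ → Eu (d - k) → Set (levelSet ξ)}
  {sel : levelSet ξ → levelSet ξ → Eu (d - k) → ℝ}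

lemma continuous_gradient (hVb : ContDiff ℝ 2 Vb) : Continuous (gradient Vb) := by
  have := hVb.continuous_fderiv two_ne_zero
  exact (InnerProductSpace.toDual ℝ (Eu d)).symm.continuous.comp this

lemma measurable_velocity (hVb : ContDiff ℝ 2 Vb) (hU : IsTangentFrame ξ U) :
    Measurable fun p : levelSet ξ × levelSet ξ => velocity ξ Vb τ U p.1 p.2 := by
  have h1 : Measurable fun p : levelSet ξ × levelSet ξ => gradient Vb (p.1 : Eu d) :=
    (continuous_gradient hVb).measurable.comp (measurable_subtype_coe.comp measurable_fst)
  have h2 : Measurable fun p : levelSet ξ × levelSet ξ =>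
      (p.2 : Eu d) - p.1 + τ • gradient Vb (p.1 : Eu d) :=
    ((measurable_subtype_coe.comp measurable_snd).sub
      (measurable_subtype_coe.comp measurable_fst)).add (h1.const_smul τ)
  have h3 := measurable_act (A := fun p : levelSet ξ × levelSet ξ => (U p.1)ᵀ)
    (fun i j => (hU.measurable j i).comp measurable_fst) h2
  exact h3.const_smul (1 / Real.sqrt (2 * τ))

attribute [local irreducible] velocity

lemma measurable_velocity_right (x : levelSet ξ) : Measurable (velocity ξ Vb τ U x) := by
  rw [funext (velocity_eq Vb τ U x)]
  exact ((velocityLin τ U x).continuous.comp continuous_subtype_val).measurable.add_const _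

lemma mem_swap_admissibleSet {x y : levelSet ξ} (h : (x, y) ∈ admissibleSet ξ Ψ) :
    (y, x) ∈ admissibleSet ξ Ψ := ⟨h.2, h.1⟩

lemma measurable_sel (hτ : 0 < τ) (hVb : ContDiff ℝ 2 Vb) (hU : IsTangentFrame ξ U)
    (hΨ : ProjectionAssumption ξ Vb τ U Ψ) (hsel : IsSelectionProbability ξ Ψ sel) :
    Measurable fun p : admissibleSet ξ Ψ =>
      sel p.1.2 p.1.1 (velocity ξ Vb τ U p.1.1 p.1.2) := by
  have h1 : Measurable fun p : admissibleSet ξ Ψ =>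
      (p.1.2, p.1.1, velocity ξ Vb τ U p.1.1 p.1.2) :=
    (measurable_snd.comp measurable_subtype_coe).prodMk
      ((measurable_fst.comp measurable_subtype_coe).prodMk
        ((measurable_velocity hVb hU).comp measurable_subtype_coe))
  exact hsel.measurable.comp
    (h1.subtype_mk (h := fun p => (mem_imPsi_iff hτ hU hΨ).1 p.2.1))

lemma measurable_moveProb (hτ : 0 < τ) (hV : Continuous V) (hVb : ContDiff ℝ 2 Vb)
    (hU : IsTangentFrame ξ U)
    (hΨ : ProjectionAssumption ξ Vb τ U Ψ) (hsel : IsSelectionProbability ξ Ψ sel) :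
    Measurable fun p : levelSet ξ × levelSet ξ => moveProb ξ V Vb β τ U Ψ sel p.1 p.2 := by
  have h1 := measurable_sel hτ hVb hU hΨ hsel
  have hsw : Measurable fun p : admissibleSet ξ Ψ =>
      (⟨(p.1.2, p.1.1), mem_swap_admissibleSet p.2⟩ : admissibleSet ξ Ψ) :=
    (measurable_swap.comp measurable_subtype_coe).subtype_mk
  have h2 : Measurable fun p : admissibleSet ξ Ψ =>
      sel p.1.1 p.1.2 (velocity ξ Vb τ U p.1.2 p.1.1) := h1.comp hsw
  have hv : Measurable fun p : admissibleSet ξ Ψ => velocity ξ Vb τ U p.1.1 p.1.2 :=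
    (measurable_velocity hVb hU).comp measurable_subtype_coe
  have hv' : Measurable fun p : admissibleSet ξ Ψ => velocity ξ Vb τ U p.1.2 p.1.1 :=
    hv.comp hsw
  have hVx : Measurable fun p : admissibleSet ξ Ψ => V p.1.1 :=
    (hV.comp (by fun_prop)).measurable
  have hVy : Measurable fun p : admissibleSet ξ Ψ => V p.1.2 :=
    (hV.comp (by fun_prop)).measurable
  have hacc : Measurable fun p : admissibleSet ξ Ψ =>
      acceptProb ξ V Vb β τ U sel p.1.2 p.1.1 := by
    simp only [acceptProb]
    refine measurable_const.min ((h2.div h1).mul (Real.measurable_exp.comp ?_))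
    exact ((hVy.add ((hv'.norm.pow_const 2).const_mul _)).sub
      (hVx.add ((hv.norm.pow_const 2).const_mul _))).const_mul _
  have h3 := h1.ennreal_ofReal.mul hacc.ennreal_ofReal
  refine measurable_of_restrict_of_restrict_compl hΨ.measurable ?_ ?_
  · convert h3 using 1
    funext p
    exact if_pos p.2
  · convert measurable_const (a := (0 : ENNReal)) using 1
    funext p
    exact if_neg p.2

/-- The density with respect to the surface measure of the part of the transition kernel that
describes the accepted moves. -/
def moveDensity (ξ : Eu d → Eu k) (V Vb : Eu d → ℝ) (β τ : ℝ)
    (U : levelSet ξ → Matrix (Fin d) (Fin (d - k)) ℝ)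
    (Ψ : levelSet ξ → Eu (d - k) → Set (levelSet ξ))
    (sel : levelSet ξ → levelSet ξ → Eu (d - k) → ℝ) (x y : levelSet ξ) : ENNReal :=
  ENNReal.ofReal (tangentJac U (velocityLin τ U x) y)
    * (moveProb ξ V Vb β τ U Ψ sel x y
      * ENNReal.ofReal (gaussianDensity β (d - k) (velocity ξ Vb τ U x y)))

lemma tangentJac_velocityLin (x y : levelSet ξ) :
    tangentJac U (velocityLin τ U x) y
      = |((1 / Real.sqrt (2 * τ)) • ((U x)ᵀ * U y)).det| := by
  rw [tangentJac, velocityLin, ← det_actL]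
  congr 2
  ext1 v
  simp [act, Matrix.smul_mulVec, Matrix.mulVec_mulVec]

lemma tangentJac_velocityLin_comm (x y : levelSet ξ) :
    tangentJac U (velocityLin τ U x) y = tangentJac U (velocityLin τ U y) x := by
  rw [tangentJac_velocityLin, tangentJac_velocityLin, ← Matrix.det_transpose,
    Matrix.transpose_smul, Matrix.transpose_mul, Matrix.transpose_transpose]

lemma measurable_moveDensity (hτ : 0 < τ) (hV : Continuous V) (hVb : ContDiff ℝ 2 Vb)
    (hU : IsTangentFrame ξ U)
    (hΨ : ProjectionAssumption ξ Vb τ U Ψ) (hsel : IsSelectionProbability ξ Ψ sel) :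
    Measurable fun p : levelSet ξ × levelSet ξ => moveDensity ξ V Vb β τ U Ψ sel p.1 p.2 := by
  refine Measurable.mul ?_ ((measurable_moveProb hτ hV hVb hU hΨ hsel).mul
    ((measurable_gaussianDensity β _).comp (measurable_velocity hVb hU)).ennreal_ofReal)
  refine Measurable.ennreal_ofReal ?_
  simp_rw [tangentJac_velocityLin]
  refine (measurable_det fun i j => ?_).abs
  simp only [Matrix.smul_apply, Matrix.mul_apply, Matrix.transpose_apply]
  have h1 : Measurable fun p : levelSet ξ × levelSet ξ => ∑ l, U p.1 l i * U p.2 l j :=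
    Finset.measurable_fun_sum _ fun l _ => ((hU.measurable l i).comp measurable_fst).mul
      ((hU.measurable l j).comp measurable_snd)
  exact h1.const_smul (1 / Real.sqrt (2 * τ))

/-- Detailed balance. -/
lemma moveDensity_symm (hτ : 0 < τ) (hU : IsTangentFrame ξ U)
    (hΨ : ProjectionAssumption ξ Vb τ U Ψ) (hsel : IsSelectionProbability ξ Ψ sel)
    (x y : levelSet ξ) :
    ENNReal.ofReal (Real.exp (-β * V x)) * moveDensity ξ V Vb β τ U Ψ sel x y
      = ENNReal.ofReal (Real.exp (-β * V y)) * moveDensity ξ V Vb β τ U Ψ sel y x := by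
  rw [moveDensity, moveDensity, tangentJac_velocityLin_comm x y, mul_left_comm,
    mul_left_comm (ENNReal.ofReal (Real.exp (-β * V y)))]
  congr 1
  by_cases h : (x, y) ∈ admissibleSet ξ Ψ
  · have h' := mem_swap_admissibleSet h
    have key {x y : levelSet ξ} (h : (x, y) ∈ admissibleSet ξ Ψ) :
        ENNReal.ofReal (Real.exp (-β * V x)) * (moveProb ξ V Vb β τ U Ψ sel x y
          * ENNReal.ofReal (gaussianDensity β (d - k) (velocity ξ Vb τ U x y)))
        = ENNReal.ofReal ((2 * Real.pi / β) ^ (-((d - k : ℕ) : ℝ) / 2) * min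
          (sel y x (velocity ξ Vb τ U x y)
            * Real.exp (-β * (V x + 1 / 2 * ‖velocity ξ Vb τ U x y‖ ^ 2)))
          (sel x y (velocity ξ Vb τ U y x)
            * Real.exp (-β * (V y + 1 / 2 * ‖velocity ξ Vb τ U y x‖ ^ 2)))) := by
      have hs := hsel.pos _ _ _ ((mem_imPsi_iff hτ hU hΨ).1 h.1)
      have ha := acceptProb_nonneg (V := V) (β := β) hτ hU hΨ hsel h
      have hp : 0 < sel y x (velocity ξ Vb τ U x y)
            * Real.exp (-β * (V x + 1 / 2 * ‖velocity ξ Vb τ U x y‖ ^ 2)) := by positivity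
      rw [moveProb, if_pos h, ← ENNReal.ofReal_mul hs.le, ← ENNReal.ofReal_mul (by positivity),
        ← ENNReal.ofReal_mul (by positivity), ← mul_min_one_div hp, gaussianDensity]
      congr 1
      have e1 : acceptProb ξ V Vb β τ U sel y x = min 1 (sel x y (velocity ξ Vb τ U y x)
            * Real.exp (-β * (V y + 1 / 2 * ‖velocity ξ Vb τ U y x‖ ^ 2))
            / (sel y x (velocity ξ Vb τ U x y)
            * Real.exp (-β * (V x + 1 / 2 * ‖velocity ξ Vb τ U x y‖ ^ 2)))) := by
        rw [acceptProb, mul_div_mul_comm, ← Real.exp_sub, mul_sub]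
      rw [e1, show -β * (V x + 1 / 2 * ‖velocity ξ Vb τ U x y‖ ^ 2)
        = -β * V x + -β * ‖velocity ξ Vb τ U x y‖ ^ 2 / 2 by ring, Real.exp_add]
      ring
    rw [key h, key h', min_comm]
  · have h' : (y, x) ∉ admissibleSet ξ Ψ := fun h' => h (mem_swap_admissibleSet h')
    rw [moveProb, moveProb, if_neg h, if_neg h']
    simp

lemma fibre_mul_comp {X E : Type*} [MeasurableSpace X] (G : X → E) (g : X → ENNReal)
    (ρ : E → ENNReal) (v : E) {S : Set X} (hS : MeasurableSet S) :
    ρ v * fibre G g v S = fibre G (fun y => g y * ρ (G y)) v S := by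
  rw [fibre_apply _ _ _ hS, fibre_apply _ _ _ hS, ← ENNReal.tsum_mul_left]
  refine tsum_congr fun y => ?_
  split_ifs with h
  · rw [h]; ring
  · rw [mul_zero]

variable [Nonempty (levelSet ξ)]

lemma aemeasurable_fibre_velocity (hkd : k ≤ d) (hξ : ContDiff ℝ ∞ ξ)
    (hU : IsTangentFrame ξ U) (x : levelSet ξ) {g : levelSet ξ → ENNReal}
    (hg : Measurable g) : AEMeasurable (fibre (velocity ξ Vb τ U x) g) volume := by
  have : PolishSpace (levelSet ξ) := (isClosed_levelSet hξ.continuous).polishSpace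
  obtain ⟨B, hBm, hBd, hBu, hBi⟩ := exists_injOn_partition hkd hξ hU (velocityLin τ U x)
  have hvel : Measurable (velocity ξ Vb τ U x) := measurable_velocity_right x
  refine aemeasurable_fibre hvel hg hBm hBd
    (fun i => ?_) ?_
  · rw [funext (velocity_eq Vb τ U x)]
    exact fun y hy z hz h => hBi i hy hz (add_right_cancel h)
  · rw [hBu, funext (velocity_eq Vb τ U x)]
    have := volume_image_critical_eq_zero hkd hξ hU (velocityLin τ U x)
      (velocityLin τ U x (τ • gradient Vb x - x))
    convert this using 3
    ext y; simp

lemma lintegral_fibre_velocity (hkd : k ≤ d) (hξ : ContDiff ℝ ∞ ξ)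
    (hU : IsTangentFrame ξ U) (x : levelSet ξ) {g : levelSet ξ → ENNReal}
    (hg : Measurable g) {S : Set (levelSet ξ)} (hS : MeasurableSet S) :
    ∫⁻ v, fibre (velocity ξ Vb τ U x) g v S = ∫⁻ y in S,
      ENNReal.ofReal (tangentJac U (velocityLin τ U x) y) * g y ∂(surfaceMeasure ξ) := by
  have : PolishSpace (levelSet ξ) := (isClosed_levelSet hξ.continuous).polishSpace
  obtain ⟨B, hBm, hBd, hBu, hBi⟩ := exists_injOn_partition hkd hξ hU (velocityLin τ U x)
  have hcompl : {y | tangentJac U (velocityLin τ U x) y ≠ 0}ᶜ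
      = {y | tangentJac U (velocityLin τ U x) y = 0} := by ext y; simp
  have hJ : Measurable fun y => ENNReal.ofReal (tangentJac U (velocityLin τ U x) y) :=
    (measurable_tangentJac hU _).ennreal_ofReal
  have hvel : Measurable (velocity ξ Vb τ U x) := measurable_velocity_right x
  have hBi' : ∀ i, Set.InjOn (velocity ξ Vb τ U x) (B i) := by
    rw [funext (velocity_eq Vb τ U x)]
    exact fun i y hy z hz h => hBi i hy hz (add_right_cancel h)
  have hnull : volume (velocity ξ Vb τ U x '' (⋃ i, B i)ᶜ) = 0 := by
    rw [hBu, funext (velocity_eq Vb τ U x), hcompl]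
    exact volume_image_critical_eq_zero hkd hξ hU (velocityLin τ U x) _
  have hcrit : (surfaceMeasure ξ).withDensity
      (fun y => ENNReal.ofReal (tangentJac U (velocityLin τ U x) y)) (⋃ i, B i)ᶜ = 0 := by
    have hm : MeasurableSet {y | tangentJac U (velocityLin τ U x) y = 0} :=
      measurable_tangentJac hU _ (measurableSet_singleton 0)
    rw [hBu, hcompl, withDensity_apply _ hm]
    refine (setLIntegral_congr_fun (g := fun _ => 0) hm fun y hy => ?_).trans lintegral_zero
    rw [show tangentJac U (velocityLin τ U x) y = 0 from hy, ENNReal.ofReal_zero]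
  have harea (A : Set (levelSet ξ)) (hA : MeasurableSet A)
      (hinj : Set.InjOn (velocity ξ Vb τ U x) A) : volume (velocity ξ Vb τ U x '' A)
        = (surfaceMeasure ξ).withDensity
          (fun y => ENNReal.ofReal (tangentJac U (velocityLin τ U x) y)) A := by
    rw [withDensity_apply _ hA]
    rw [funext (velocity_eq Vb τ U x)] at hinj ⊢
    exact volume_image_eq_setLIntegral hkd hξ hU _ _ hA hinj
  rw [lintegral_fibre (μ := (surfaceMeasure ξ).withDensity
      fun y => ENNReal.ofReal (tangentJac U (velocityLin τ U x) y))
    hvel hg hBm hBd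
    hBi' hnull hcrit harea hS, setLIntegral_withDensity_eq_setLIntegral_mul _ hJ hg hS]
  rfl

lemma lintegral_fibre_gaussian (hkd : k ≤ d) (hξ : ContDiff ℝ ∞ ξ) (hτ : 0 < τ)
    (hV : Continuous V) (hVb : ContDiff ℝ 2 Vb) (hU : IsTangentFrame ξ U)
    (hΨ : ProjectionAssumption ξ Vb τ U Ψ) (hsel : IsSelectionProbability ξ Ψ sel)
    (x : levelSet ξ) {S : Set (levelSet ξ)} (hS : MeasurableSet S) :
    ∫⁻ v, fibre (velocity ξ Vb τ U x) (moveProb ξ V Vb β τ U Ψ sel x) v S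
        ∂(gaussian β (d - k))
      = ∫⁻ y in S, moveDensity ξ V Vb β τ U Ψ sel x y ∂(surfaceMeasure ξ) := by
  have hg : Measurable (moveProb ξ V Vb β τ U Ψ sel x) :=
    (measurable_moveProb hτ hV hVb hU hΨ hsel).comp measurable_prodMk_left
  have hρ : Measurable fun v => ENNReal.ofReal (gaussianDensity β (d - k) v) :=
    (measurable_gaussianDensity β _).ennreal_ofReal
  have hvel : Measurable (velocity ξ Vb τ U x) := measurable_velocity_right x
  have hfib : AEMeasurable (fun v =>
      fibre (velocity ξ Vb τ U x) (moveProb ξ V Vb β τ U Ψ sel x) v S) volume :=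
    (Measure.measurable_coe hS).comp_aemeasurable
    (aemeasurable_fibre_velocity (τ := τ) hkd hξ hU x hg)
  rw [gaussian_eq_withDensity, lintegral_withDensity_eq_lintegral_mul₀ hρ.aemeasurable hfib]
  unfold moveDensity
  rw [← lintegral_fibre_velocity (τ := τ) hkd hξ hU x
    (g := fun y => moveProb ξ V Vb β τ U Ψ sel x y
      * ENNReal.ofReal (gaussianDensity β (d - k) (velocity ξ Vb τ U x y)))
    (hg.mul (hρ.comp hvel)) hS]
  refine lintegral_congr fun v => ?_
  rw [← fibre_mul_comp _ _ (fun v => ENNReal.ofReal (gaussianDensity β (d - k) v)) v hS]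
  rfl

lemma lintegral_moveDensity_le_one (hkd : k ≤ d) (hξ : ContDiff ℝ ∞ ξ) (hτ : 0 < τ) (hβ : 0 < β)
    (hV : Continuous V) (hVb : ContDiff ℝ 2 Vb) (hU : IsTangentFrame ξ U)
    (hΨ : ProjectionAssumption ξ Vb τ U Ψ) (hsel : IsSelectionProbability ξ Ψ sel)
    (x : levelSet ξ) : ∫⁻ y, moveDensity ξ V Vb β τ U Ψ sel x y ∂(surfaceMeasure ξ) ≤ 1 := by
  have hprob := isProbabilityMeasure_gaussian hβ (d - k)
  rw [← setLIntegral_univ,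
    ← lintegral_fibre_gaussian hkd hξ hτ hV hVb hU hΨ hsel x MeasurableSet.univ]
  refine (lintegral_mono fun v =>
    fibre_velocity_univ_le_one (V := V) (β := β) hτ hU hΨ hsel x v).trans ?_
  simp

/-- One step of the chain from `x`: an accepted move has a density with respect to the surface
measure, and the chain stays at `x` otherwise. -/
theorem step_apply (hkd : k ≤ d) (hξ : ContDiff ℝ ∞ ξ) (hτ : 0 < τ) (hβ : 0 < β)
    (hV : Continuous V) (hVb : ContDiff ℝ 2 Vb) (hU : IsTangentFrame ξ U)
    (hΨ : ProjectionAssumption ξ Vb τ U Ψ) (hsel : IsSelectionProbability ξ Ψ sel)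
    (x : levelSet ξ) {S : Set (levelSet ξ)} (hS : MeasurableSet S) :
    step ξ V Vb β τ U Ψ sel x S
      = ∫⁻ y in S, moveDensity ξ V Vb β τ U Ψ sel x y ∂(surfaceMeasure ξ)
        + (1 - ∫⁻ y, moveDensity ξ V Vb β τ U Ψ sel x y ∂(surfaceMeasure ξ))
          * S.indicator 1 x := by
  have hprob := isProbabilityMeasure_gaussian hβ (d - k)
  have hfib : AEMeasurable (fibre (velocity ξ Vb τ U x) (moveProb ξ V Vb β τ U Ψ sel x))
      (gaussian β (d - k)) := (aemeasurable_fibre_velocity (τ := τ) hkd hξ hU x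
    ((measurable_moveProb hτ hV hVb hU hΨ hsel).comp measurable_prodMk_left)).mono_ac
      (withDensity_absolutelyContinuous _ _)
  have hΦ : Measurable fun μ : Measure (levelSet ξ) => μ + (1 - μ Set.univ) • Measure.dirac x := by
    refine Measure.measurable_of_measurable_coe _ fun S hS => ?_
    simp only [Measure.add_apply, Measure.smul_apply, smul_eq_mul]
    exact (Measure.measurable_coe hS).add
      ((measurable_const.sub (Measure.measurable_coe MeasurableSet.univ)).mul_const _)
  have hΦfib : AEMeasurable (fun v =>
      fibre (velocity ξ Vb τ U x) (moveProb ξ V Vb β τ U Ψ sel x) v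
        + (1 - fibre (velocity ξ Vb τ U x) (moveProb ξ V Vb β τ U Ψ sel x) v Set.univ)
          • Measure.dirac x) (gaussian β (d - k)) := hΦ.comp_aemeasurable hfib
  have hcoe {S : Set (levelSet ξ)} (hS : MeasurableSet S) :
      AEMeasurable (fun v => fibre (velocity ξ Vb τ U x) (moveProb ξ V Vb β τ U Ψ sel x) v S)
        (gaussian β (d - k)) := (Measure.measurable_coe hS).comp_aemeasurable hfib
  have hint {S : Set (levelSet ξ)} (hS : MeasurableSet S) :=
    lintegral_fibre_gaussian (β := β) hkd hξ hτ hV hVb hU hΨ hsel x hS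
  have hne : ∫⁻ v, fibre (velocity ξ Vb τ U x) (moveProb ξ V Vb β τ U Ψ sel x) v Set.univ
      ∂(gaussian β (d - k)) ≠ ⊤ := by
    rw [hint MeasurableSet.univ, setLIntegral_univ]
    exact ne_top_of_le_ne_top ENNReal.one_ne_top
      (lintegral_moveDensity_le_one hkd hξ hτ hβ hV hVb hU hΨ hsel x)
  rw [step, funext (stepGivenVelocity_eq (V := V) (β := β) hτ hU hΨ hsel x),
    Measure.bind_apply hS hΦfib]
  simp only [Measure.add_apply, Measure.smul_apply, smul_eq_mul, Measure.dirac_apply' _ hS]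
  have hsub : AEMeasurable (fun v => 1 - fibre (velocity ξ Vb τ U x)
      (moveProb ξ V Vb β τ U Ψ sel x) v Set.univ) (gaussian β (d - k)) :=
    aemeasurable_const.sub (hcoe MeasurableSet.univ)
  rw [lintegral_add_left' (hcoe hS), lintegral_mul_const'' _ hsub,
    lintegral_sub' (hcoe MeasurableSet.univ) hne (Filter.Eventually.of_forall fun v =>
        fibre_velocity_univ_le_one (V := V) (β := β) hτ hU hΨ hsel x v),
    hint hS, hint MeasurableSet.univ]
  simp

end Reversibility

section Main

/-- A kernel whose moves have a density in detailed balance with the weight `w`, and which stays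
put with the remaining probability, is reversible with respect to `w σ`. -/
theorem isReversible_of_density {X : Type*} [MeasurableSpace X] {σ : Measure X} [SFinite σ]
    {w : X → ENNReal} (hw : Measurable w) {T : X → X → ENNReal}
    (hT : Measurable fun p : X × X => T p.1 p.2) (hsymm : ∀ x y, w x * T x y = w y * T y x)
    {q : Kernel X X} (hq : ∀ x (S : Set X), MeasurableSet S → q x S
      = ∫⁻ y in S, T x y ∂σ + (1 - ∫⁻ y, T x y ∂σ) * S.indicator 1 x) (c : ENNReal) :
    q.IsReversible (c • σ.withDensity w) := by
  have hwT : Measurable fun p : X × X => w p.1 * T p.1 p.2 := (hw.comp measurable_fst).mul hT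
  have hsplit {A B : Set X} (hA : MeasurableSet A) (hB : MeasurableSet B) :
      ∫⁻ x in A, q x B ∂(c • σ.withDensity w) = c * (∫⁻ x in A, ∫⁻ y in B, w x * T x y ∂σ ∂σ
        + ∫⁻ x in B ∩ A, w x * (1 - ∫⁻ y, T x y ∂σ) ∂σ) := by
    have hinner : Measurable fun x => ∫⁻ y in B, w x * T x y ∂σ := hwT.lintegral_prod_right'
    rw [Measure.restrict_smul, lintegral_smul_measure, smul_eq_mul,
      setLIntegral_withDensity_eq_setLIntegral_mul _ hw (q.measurable_coe hB) hA,
      ← setLIntegral_indicator hB, ← lintegral_add_left hinner]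
    congr 1
    refine lintegral_congr fun x => ?_
    have hTx : Measurable fun y => T x y := hT.comp measurable_prodMk_left
    rw [Pi.mul_apply, lintegral_const_mul _ hTx, hq x B hB, mul_add]
    congr 1
    by_cases hx : x ∈ B <;> simp [hx]
  intro A B hA hB
  rw [hsplit hA hB, hsplit hB hA, Set.inter_comm B A, lintegral_lintegral_swap hwT.aemeasurable]
  simp_rw [hsymm]

variable {d k : ℕ} {ξ : Eu d → Eu k} {V Vb : Eu d → ℝ} {β τ : ℝ}
  {U : levelSet ξ → Matrix (Fin d) (Fin (d - k)) ℝ}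
  {Ψ : levelSet ξ → Eu (d - k) → Set (levelSet ξ)}
  {sel : levelSet ξ → levelSet ξ → Eu (d - k) → ℝ}

lemma measurable_weight (hV : Continuous V) :
    Measurable fun x : levelSet ξ => ENNReal.ofReal (Real.exp (-β * V x)) :=
  (Real.continuous_exp.comp (continuous_const.mul
    (hV.comp continuous_subtype_val))).measurable.ennreal_ofReal

variable [Nonempty (levelSet ξ)]

theorem isProbabilityMeasure_targetMeasure (hkd : k ≤ d) (hξ : ConstraintAssumption ξ V Vb)
    (hU : IsTangentFrame ξ U) : IsProbabilityMeasure (targetMeasure ξ V β) := by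
  have hfin := surfaceMeasure_univ_lt_top hkd hξ.smooth hξ.compact hU
  have hpos := surfaceMeasure_ne_zero hkd hξ.smooth hU
  have hw := measurable_weight (ξ := ξ) (β := β) hξ.V_C2.continuous
  have h0 : weightedSurface ξ V β Set.univ ≠ 0 := by
    rw [weightedSurface, withDensity_apply _ MeasurableSet.univ, setLIntegral_univ, Ne,
      lintegral_eq_zero_iff hw]
    intro h
    refine hpos ?_
    rw [Measure.measure_univ_eq_zero, ← ae_eq_bot, ← Filter.eventually_false_iff_eq_bot]
    filter_upwards [h] with x hx
    exact (ENNReal.ofReal_pos.2 (Real.exp_pos _)).ne' hx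
  have htop : weightedSurface ξ V β Set.univ ≠ ⊤ := by
    have : CompactSpace (levelSet ξ) := isCompact_iff_compactSpace.1 hξ.compact
    have hc : Continuous fun x : levelSet ξ => Real.exp (-β * V x) :=
      Real.continuous_exp.comp (continuous_const.mul
        (hξ.V_C2.continuous.comp continuous_subtype_val))
    obtain ⟨C, hC⟩ := (isCompact_range hc).bddAbove
    rw [weightedSurface, withDensity_apply _ MeasurableSet.univ, setLIntegral_univ]
    refine ((lintegral_mono (g := fun _ => ENNReal.ofReal C) fun x =>
      ENNReal.ofReal_le_ofReal (hC ⟨x, rfl⟩)).trans_lt ?_).ne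
    rw [lintegral_const]
    exact ENNReal.mul_lt_top ENNReal.ofReal_lt_top hfin
  refine ⟨?_⟩
  rw [targetMeasure, Measure.smul_apply, smul_eq_mul, ENNReal.inv_mul_cancel h0 htop]

theorem isReversible_of_forall_eq_step (hkd : k ≤ d) (hξ : ConstraintAssumption ξ V Vb)
    (hτ : 0 < τ) (hβ : 0 < β) (hU : IsTangentFrame ξ U)
    (hΨ : ProjectionAssumption ξ Vb τ U Ψ) (hsel : IsSelectionProbability ξ Ψ sel)
    {q : Kernel (levelSet ξ) (levelSet ξ)} (hq : ∀ x, q x = step ξ V Vb β τ U Ψ sel x) :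
    q.IsReversible (targetMeasure ξ V β) := by
  have hV := hξ.V_C2.continuous
  have hfin : IsFiniteMeasure (surfaceMeasure ξ) :=
    ⟨surfaceMeasure_univ_lt_top hkd hξ.smooth hξ.compact hU⟩
  refine isReversible_of_density (measurable_weight hV)
    (measurable_moveDensity (β := β) hτ hV hξ.Vb_C2 hU hΨ hsel)
    (moveDensity_symm hτ hU hΨ hsel) (fun x S hS => ?_) _
  rw [hq, step_apply hkd hξ.smooth hτ hβ hV hξ.Vb_C2 hU hΨ hsel x hS]

/-- The transition kernel of the algorithm. -/
theorem exists_stepKernel (hkd : k ≤ d) (hξ : ConstraintAssumption ξ V Vb)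
    (hτ : 0 < τ) (hβ : 0 < β) (hU : IsTangentFrame ξ U)
    (hΨ : ProjectionAssumption ξ Vb τ U Ψ) (hsel : IsSelectionProbability ξ Ψ sel) :
    ∃ q : Kernel (levelSet ξ) (levelSet ξ), IsMarkovKernel q ∧
      ∀ x, q x = step ξ V Vb β τ U Ψ sel x := by
  have hV := hξ.V_C2.continuous
  have hfin : IsFiniteMeasure (surfaceMeasure ξ) :=
    ⟨surfaceMeasure_univ_lt_top hkd hξ.smooth hξ.compact hU⟩
  have hT := measurable_moveDensity (β := β) hτ hV hξ.Vb_C2 hU hΨ hsel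
  have hstep (x : levelSet ξ) {S : Set (levelSet ξ)} (hS : MeasurableSet S) :=
    step_apply hkd hξ.smooth hτ hβ hV hξ.Vb_C2 hU hΨ hsel x hS
  have hm : Measurable (step ξ V Vb β τ U Ψ sel) := by
    refine Measure.measurable_of_measurable_coe _ fun S hS => ?_
    simp_rw [fun x => hstep x hS]
    exact hT.lintegral_prod_right'.add
      ((measurable_const.sub hT.lintegral_prod_right').mul (measurable_one.indicator hS))
  refine ⟨⟨step ξ V Vb β τ U Ψ sel, hm⟩, ⟨fun x => ⟨?_⟩⟩, fun x => rfl⟩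
  change step ξ V Vb β τ U Ψ sel x Set.univ = 1
  rw [hstep x MeasurableSet.univ, setLIntegral_univ, Set.indicator_univ, Pi.one_apply, mul_one]
  exact add_tsub_cancel_of_le
    (lintegral_moveDensity_le_one hkd hξ.smooth hτ hβ hV hξ.Vb_C2 hU hΨ hsel x)

end Main

end MultiProjMALA

end

theorem mainTheorem1 (d k : ℕ) (hk : 1 ≤ k) (hkd : k < d)
    (ξ : MultiProjMALA.Eu d → MultiProjMALA.Eu k) (V Vb : MultiProjMALA.Eu d → ℝ)
    (hξ : MultiProjMALA.ConstraintAssumption ξ V Vb)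
    (β τ : ℝ) (hβ : 0 < β) (hτ : 0 < τ)
    (U : MultiProjMALA.levelSet ξ → Matrix (Fin d) (Fin (d - k)) ℝ)
    (hU : MultiProjMALA.IsTangentFrame ξ U)
    (Ψ : MultiProjMALA.levelSet ξ → MultiProjMALA.Eu (d - k) → Set (MultiProjMALA.levelSet ξ))
    (hΨ : MultiProjMALA.ProjectionAssumption ξ Vb τ U Ψ)
    (sel : MultiProjMALA.levelSet ξ → MultiProjMALA.levelSet ξ → MultiProjMALA.Eu (d - k) → ℝ)
    (hsel : MultiProjMALA.IsSelectionProbability ξ Ψ sel) :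
    IsProbabilityMeasure (MultiProjMALA.targetMeasure ξ V β) ∧
    ∃ q : Kernel (MultiProjMALA.levelSet ξ) (MultiProjMALA.levelSet ξ),
      IsMarkovKernel q ∧
      (∀ x, q x = MultiProjMALA.step ξ V Vb β τ U Ψ sel x) ∧
      MultiProjMALA.IsReversibleChain q (MultiProjMALA.targetMeasure ξ V β) ∧
      q.Invariant (MultiProjMALA.targetMeasure ξ V β) := by
  obtain ⟨p, -⟩ := hΨ.nonempty
  have : Nonempty (MultiProjMALA.levelSet ξ) := ⟨p.1⟩
  have hν : IsProbabilityMeasure (MultiProjMALA.targetMeasure ξ V β) :=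
    MultiProjMALA.isProbabilityMeasure_targetMeasure hkd.le hξ hU
  obtain ⟨q, hqM, hq⟩ := MultiProjMALA.exists_stepKernel hkd.le hξ hτ hβ hU hΨ hsel
  have hrev := MultiProjMALA.isReversible_of_forall_eq_step hkd.le hξ hτ hβ hU hΨ hsel hq
  exact ⟨hν, q, hqM, hq, MultiProjMALA.isReversibleChain_of_isReversible hrev, hrev.invariant⟩
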